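/- For a finite group $G$, let $\operatorname{Irr}(G)$ be the set of its complex irreducible characters, let $\mathbb{Q}(\chi)=\mathbb{Q}(\chi(x):x\in G)$ for $\chi\in\operatorname{Irr}(G)$, and let $\mathbb{Q}(G)=\mathbb{Q}(\chi(x):x\in G,\ \chi\in\operatorname{Irr}(G))$; these are subfields of $\mathbb{C}$. The group $G$ is called \emph{rational} if $\mathbb{Q}(\chi)=\mathbb{Q}$ for all $\chi\in\operatorname{Irr}(G)$, and \emph{cut} if all central units of its integral group ring are trivial, i.e. $\mathcal{Z}(\mathrm{U}(\mathbb{Z}G))=\pm\mathcal{Z}(G)$. (1) Let $G_1$ and $G_2$ be finite cut groups. Then $G_1\times G_2$ is cut if and only if one of the following holds: (i) $G_1$ or $G_2$ is rational; (ii) $\mathbb{Q}(G_1)=\mathbb{Q}(G_2)=\mathbb{Q}(\sqrt{-d})$ for some integer $d\ge 1$. (2) Let $(G_i)_{i\in I}$ be a finite family of finite cut groups. Then $\prod_{i\in I}G_i$ is cut if and only if one of the following holds: (i) at most one of the groups $G_i$ is not rational; (ii) there is an integer $d\ge 1$ such that $\mathbb{Q}(G_i)=\mathbb{Q}(\sqrt{-d})$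 for every $i\in I$ for which $G_i$ is not rational. -/

import Mathlib

open scoped IntermediateField

noncomputable section

namespace CutGroups

/-- `G` is a cut group: the centre of the unit group of the integral group ring `ℤG` is `±Z(G)`,
i.e. all central units of `ℤG` are trivial. -/
def IsCut (G : Type*) [Group G] : Prop :=
  (Subgroup.center (MonoidAlgebra ℤ G)ˣ : Set (MonoidAlgebra ℤ G)ˣ) =
    {u : (MonoidAlgebra ℤ G)ˣ | ∃ g ∈ Subgroup.center G,
      (u : MonoidAlgebra ℤ G) = MonoidAlgebra.of ℤ G g ∨
      (u : MonoidAlgebra ℤ G) = -MonoidAlgebra.of ℤ G g}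

/-- `Irr(G)`: the characters of the irreducible finite-dimensional complex representations
of `G`. (Every finite-dimensional complex space has an isomorphic copy in `Type`.) -/
def Irr (G : Type*) [Group G] : Set (G → ℂ) :=
  {χ | ∃ (V : Type) (_ : AddCommGroup V) (_ : Module ℂ V) (_ : FiniteDimensional ℂ V)
    (ρ : Representation ℂ G V), ρ.IsIrreducible ∧ ρ.character = χ}

/-- The character field `ℚ(χ) = ℚ(χ(x) : x ∈ G)`, a subfield of `ℂ`. -/
def charField {G : Type*} (χ : G → ℂ) : IntermediateField ℚ ℂ :=
  IntermediateField.adjoin ℚ (Set.range χ)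

/-- `ℚ(G) = ℚ(χ(x) : x ∈ G, χ ∈ Irr(G))`, a subfield of `ℂ`. -/
def groupField (G : Type*) [Group G] : IntermediateField ℚ ℂ :=
  IntermediateField.adjoin ℚ {z | ∃ χ ∈ Irr G, ∃ x : G, χ x = z}

/-- `G` is rational: `ℚ(χ) = ℚ` for every complex irreducible character `χ` of `G`. -/
def IsRational (G : Type*) [Group G] : Prop :=
  ∀ χ ∈ Irr G, charField χ = ⊥

/-- The subfield `ℚ(√-d)` of `ℂ`. -/
def imagQuadField (d : ℕ) : IntermediateField ℚ ℂ :=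
  ℚ⟮((Real.sqrt d : ℝ) : ℂ) * Complex.I⟯

end CutGroups

end

open scoped IntermediateField

noncomputable section

namespace CutGroups

open MonoidAlgebra

/-! ### Spherical functions of a finite group -/

/-! Two facts carry the theorem: a finite group is cut exactly when each of its character fields is
`ℚ` or imaginary quadratic (`isCut_iff_forall_charField`), and the character fields of a direct
product are exactly the composites of character fields of the factors (`mem_charFields_prod_iff`,
`mem_charFields_pi_iff`). A composite of two fields other than `ℚ` is `ℚ` or imaginary quadratic
only if the two coincide, so the rest is lattice theory (`forall_isRatOrImagQuad_iSup_iff`).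

Irreducible characters enter through the normalised functions `χ / χ 1`, which have the same fields
and are characterised by one averaging identity. That identity passes easily to products, and it
says that `φ` is multiplicative on the centre of the group algebra. The centre `Z` of `ℚG` is
reduced and Artinian, hence a product of number fields; its points in `ℂ` are the spherical
functions, with image `ℚ(χ)`.

If all these fields are `ℚ` or imaginary quadratic and `u` is a central unit of `ℤG` with antipode
`u*`, then `φ(u u*) = |φ(u)|²` is a nonnegative rational integer and a unit, hence `1`. Spherical
functions separate `Z`, so `u u* = 1`; its coefficient at the identity is the sum of the squares of
the coefficients of `u`, so `u = ±g`. Conversely, a power of any unit of the ring of integers of a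
component of `Z`, extended by `1` on the other components, is a central unit of `ℤG`. In a cut group
it is trivial, hence torsion, and Dirichlet's unit theorem leaves only `ℚ` and imaginary quadratic
fields. -/

/-- The spherical functions of a finite group `G`: the functions `φ` with `φ 1 = 1` such that
`φ x * φ y` is the average of `φ` over the products of `x` with the conjugates of `y`.
They are the normalised irreducible characters `χ / χ 1`. -/
structure IsSpherical {G : Type*} [Group G] [Fintype G] (φ : G → ℂ) : Prop where
  map_one : φ 1 = 1
  sum_mul_conj : ∀ x y, ∑ h, φ (x * (h * y * h⁻¹)) = Fintype.card G * (φ x * φ y)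

section Spherical

variable {G : Type*} [Group G] [Fintype G] {φ ψ : G → ℂ}

theorem card_ne_zero_complex (G : Type*) [Group G] [Fintype G] : (Fintype.card G : ℂ) ≠ 0 :=
  Nat.cast_ne_zero.mpr Fintype.card_ne_zero

theorem isSpherical_one : IsSpherical (1 : G → ℂ) :=
  ⟨rfl, fun x y => by simp⟩

/-- The case `x = 1` of the identity makes `φ y` the average of `φ` over the conjugates of `y`. -/
theorem IsSpherical.conj (hφ : IsSpherical φ) (k y : G) : φ (k * y * k⁻¹) = φ y := by
  have h : ∀ y, ∑ h, φ (h * y * h⁻¹) = Fintype.card G * φ y := fun y => by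
    simpa [hφ.map_one] using hφ.sum_mul_conj 1 y
  have h1 : ∑ h, φ (h * (k * y * k⁻¹) * h⁻¹) = ∑ h, φ (h * y * h⁻¹) := by
    rw [← Equiv.sum_comp (Equiv.mulRight k) (fun h => φ (h * y * h⁻¹))]
    refine Finset.sum_congr rfl fun h _ => ?_
    simp [mul_assoc]
  rw [h, h] at h1
  exact mul_left_cancel₀ (card_ne_zero_complex G) h1

theorem IsSpherical.mul_comm (hφ : IsSpherical φ) (x y : G) : φ (x * y) = φ (y * x) := by
  rw [← hφ.conj x (y * x)]
  simp [mul_assoc]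

/-- The conjugate dual of a spherical function is spherical. -/
theorem IsSpherical.star_inv (hφ : IsSpherical φ) :
    IsSpherical (fun g => starRingEnd ℂ (φ g⁻¹)) := by
  refine ⟨by simp [hφ.map_one], fun x y => ?_⟩
  rw [← map_sum]
  have : ∑ h, φ (x * (h * y * h⁻¹))⁻¹ = ∑ h, φ (x⁻¹ * (h * y⁻¹ * h⁻¹)) := by
    refine Finset.sum_congr rfl fun h _ => ?_
    rw [hφ.mul_comm]
    simp [mul_assoc]
  rw [this, hφ.sum_mul_conj]
  simp

/-- Convolution with a class function may be averaged over conjugates of the summation variable, so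
`φ` is an eigenfunction of it. -/
theorem IsSpherical.sum_mul_left (hφ : IsSpherical φ) (hψ : IsSpherical ψ) (x : G) :
    ∑ g, ψ g⁻¹ * φ (x * g) = φ x * ∑ g, ψ g⁻¹ * φ g := by
  have h1 : ∀ k : G, ∑ g, ψ g⁻¹ * φ (x * g) = ∑ g, ψ g⁻¹ * φ (x * (k * g * k⁻¹)) := by
    intro k
    rw [← Equiv.sum_comp (MulAut.conj k).toEquiv (fun g => ψ g⁻¹ * φ (x * g))]
    refine Finset.sum_congr rfl fun g _ => ?_
    have : ψ (k * g * k⁻¹)⁻¹ = ψ g⁻¹ := by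
      rw [← hψ.conj k g⁻¹]
      simp [mul_assoc]
    simp only [MulEquiv.toEquiv_eq_coe, MulEquiv.coe_toEquiv, MulAut.conj_apply, this]
  apply mul_left_cancel₀ (card_ne_zero_complex G)
  calc (Fintype.card G : ℂ) * ∑ g, ψ g⁻¹ * φ (x * g)
      = ∑ _k : G, ∑ g, ψ g⁻¹ * φ (x * g) := by simp
    _ = ∑ k : G, ∑ g, ψ g⁻¹ * φ (x * (k * g * k⁻¹)) := Finset.sum_congr rfl fun k _ => h1 k
    _ = ∑ g, ∑ k : G, ψ g⁻¹ * φ (x * (k * g * k⁻¹)) := Finset.sum_comm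
    _ = ∑ g, ψ g⁻¹ * (Fintype.card G * (φ x * φ g)) := by
        refine Finset.sum_congr rfl fun g _ => ?_
        rw [← Finset.mul_sum, hφ.sum_mul_conj]
    _ = _ := by
        rw [Finset.mul_sum, Finset.mul_sum]
        exact Finset.sum_congr rfl fun g _ => by ring

/-- Spherical functions that are not orthogonal are equal. -/
theorem IsSpherical.eq_of_sum_ne_zero (hφ : IsSpherical φ) (hψ : IsSpherical ψ)
    (h : ∑ g, ψ g⁻¹ * φ g ≠ 0) : φ = ψ := by
  funext x
  have h1 := hφ.sum_mul_left hψ x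
  have h2 := hψ.sum_mul_left hφ x
  have h3 : ∑ g, φ g⁻¹ * ψ g = ∑ g, ψ g⁻¹ * φ g := by
    rw [← Equiv.sum_comp (Equiv.inv G)]
    exact Finset.sum_congr rfl fun g _ => by simp [_root_.mul_comm]
  -- Both eigenfunction identities evaluate the same convolution: it is `φ x` and also `ψ x` times
  -- one pairing, which is nonzero.
  have h4 : ∑ g, φ g⁻¹ * ψ (x * g) = ∑ g, ψ g⁻¹ * φ (x * g) := by
    rw [← Equiv.sum_comp ((Equiv.inv G).trans (Equiv.mulLeft x⁻¹))]
    refine Finset.sum_congr rfl fun g _ => ?_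
    simp only [Equiv.trans_apply, Equiv.inv_apply, Equiv.coe_mulLeft, mul_inv_rev, inv_inv,
      mul_inv_cancel_left]
    rw [hφ.mul_comm, _root_.mul_comm]
  rw [h3, h4, h1] at h2
  exact mul_right_cancel₀ h h2

/-- The pairing of `φ` with its conjugate dual is `∑ |φ g|²`, positive because `φ 1 = 1`, so the two
coincide. -/
theorem IsSpherical.map_inv (hφ : IsSpherical φ) (g : G) : φ g⁻¹ = starRingEnd ℂ (φ g) := by
  have key : φ = fun g => starRingEnd ℂ (φ g⁻¹) := by
    refine hφ.eq_of_sum_ne_zero hφ.star_inv ?_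
    have h : ∑ g, starRingEnd ℂ (φ g⁻¹⁻¹) * φ g = ((∑ g, Complex.normSq (φ g) : ℝ) : ℂ) := by
      push_cast
      exact Finset.sum_congr rfl fun g _ => by rw [inv_inv, Complex.normSq_eq_conj_mul_self]
    rw [h]
    refine Complex.ofReal_ne_zero.mpr (ne_of_gt ?_)
    refine Finset.sum_pos' (fun g _ => Complex.normSq_nonneg _) ⟨1, Finset.mem_univ _, ?_⟩
    simp [hφ.map_one]
  calc φ g⁻¹ = starRingEnd ℂ (φ g⁻¹⁻¹) := congrFun key g⁻¹
    _ = _ := by rw [inv_inv]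

end Spherical

/-! ### The functional on the group algebra defined by a function on the group -/

section Functional

variable {G : Type*} [Fintype G] (k : Type*) [CommRing k] [Algebra k ℂ]

/-- The linear extension of a function `φ : G → ℂ` to the group algebra `k[G]`. -/
def linExt (φ : G → ℂ) : MonoidAlgebra k G →ₗ[k] ℂ where
  toFun a := ∑ g, a.coeff g • φ g
  map_add' a b := by simp [add_smul, Finset.sum_add_distrib]
  map_smul' r a := by simp [mul_smul, Finset.smul_sum]

variable {k}

theorem linExt_apply (φ : G → ℂ) (a : MonoidAlgebra k G) :
    linExt k φ a = ∑ g, a.coeff g • φ g := rfl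

@[simp]
theorem linExt_single (φ : G → ℂ) (g : G) (r : k) : linExt k φ (single g r) = r • φ g := by
  classical
  simp [linExt_apply, Finsupp.single_apply, ite_smul]

variable [Group G]

theorem IsSpherical.sum_linExt {φ : G → ℂ} (hφ : IsSpherical φ) (x : G) (z : MonoidAlgebra k G) :
    ∑ h, linExt k φ (single x 1 * (single h 1 * z * single h⁻¹ 1)) =
      Fintype.card G * (φ x * linExt k φ z) := by
  induction z using MonoidAlgebra.induction_linear with
  | zero => simp
  | add a b ha hb => simp only [mul_add, add_mul, map_add, Finset.sum_add_distrib, ha, hb]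
  | single g r =>
    simp only [single_mul_single, one_mul, mul_one, linExt_single]
    rw [← Finset.smul_sum, hφ.sum_mul_conj, mul_smul_comm, mul_smul_comm]

theorem IsSpherical.linExt_mul {φ : G → ℂ} (hφ : IsSpherical φ) (a z : MonoidAlgebra k G)
    (hz : ∀ h : G, single h 1 * z = z * single h 1) :
    linExt k φ (a * z) = linExt k φ a * linExt k φ z := by
  induction a using MonoidAlgebra.induction_linear with
  | zero => simp
  | add a b ha hb => simp only [add_mul, map_add, ha, hb]
  | single x r =>
    have h1 := hφ.sum_linExt x z
    have h2 : ∀ h : G, single h (1 : k) * z * single h⁻¹ 1 = z := fun h => by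
      rw [hz, mul_assoc, single_mul_single, mul_inv_cancel, mul_one, ← one_def, mul_one]
    simp only [h2, Finset.sum_const, Finset.card_univ, nsmul_eq_mul] at h1
    have h3 := mul_left_cancel₀ (card_ne_zero_complex G) h1
    have h4 : (single x r : MonoidAlgebra k G) = r • single x 1 := by simp
    rw [h4, smul_mul_assoc, map_smul, map_smul, h3, linExt_single, one_smul, smul_mul_assoc]

end Functional

/-! ### Spherical functions and irreducible characters -/

section Irr

variable {G : Type*} [Group G]

theorem isIrreducible_of_equiv {V W : Type*} [AddCommGroup V] [Module ℂ V] [AddCommGroup W]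
    [Module ℂ W] {ρ : Representation ℂ G V} {σ : Representation ℂ G W} (e : ρ.Equiv σ)
    (h : ρ.IsIrreducible) : σ.IsIrreducible := by
  rw [Representation.irreducible_iff_isSimpleModule_asModule] at h ⊢
  have hb : Function.Bijective
      (Representation.IntertwiningMap.equivLinearMapAsModule ρ σ e.toIntertwiningMap) :=
    e.toLinearEquiv.bijective
  exact IsSimpleModule.congr (LinearEquiv.ofBijective _ hb).symm

/-- Characters of irreducible representations may be computed in any universe. -/
theorem character_mem_Irr {V : Type*} [AddCommGroup V] [Module ℂ V] [FiniteDimensional ℂ V]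
    (ρ : Representation ℂ G V) (h : ρ.IsIrreducible) : ρ.character ∈ Irr G := by
  let e : V ≃ₗ[ℂ] (Fin (Module.finrank ℂ V) → ℂ) := (Module.finBasis ℂ V).equivFun
  let σ : Representation ℂ G (Fin (Module.finrank ℂ V) → ℂ) :=
    { toFun := fun g => e.conj (ρ g)
      map_one' := by rw [map_one]; exact e.conj_id
      map_mul' := fun a b => by rw [map_mul]; exact e.conj_comp _ _ }
  have E : ρ.Equiv σ := Representation.Equiv.mk e fun g => by
    ext v
    simp [σ, LinearEquiv.conj_apply]
  exact ⟨_, _, _, inferInstance, σ, isIrreducible_of_equiv E h,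
    (Representation.char_iso E).symm⟩

/-- Schur's lemma for a linear endomorphism commuting with an irreducible representation. -/
theorem exists_eq_smul_one_of_commute {V : Type*} [AddCommGroup V] [Module ℂ V]
    [FiniteDimensional ℂ V] (ρ : Representation ℂ G V) (h : ρ.IsIrreducible)
    (T : V →ₗ[ℂ] V) (hT : ∀ g, T ∘ₗ ρ g = ρ g ∘ₗ T) : ∃ c : ℂ, T = c • LinearMap.id := by
  obtain ⟨c, hc⟩ :=
    (Representation.IsIrreducible.algebraMap_intertwiningMap_bijective_of_isAlgClosed
      (ρ := ρ)).2 ⟨T, hT⟩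
  refine ⟨c, ?_⟩
  have := congrArg Representation.IntertwiningMap.toLinearMap hc
  rw [Representation.IntertwiningMap.algebraMap_apply] at this
  exact this.symm

/-- The irreducible representation on the quotient of the group algebra by a maximal left ideal. -/
theorem exists_representation_quotient (I : Ideal (MonoidAlgebra ℂ G)) (hI : I.IsMaximal) :
    ∃ (ρ : Representation ℂ G (MonoidAlgebra ℂ G ⧸ I))
      (q : MonoidAlgebra ℂ G →ₗ[ℂ] MonoidAlgebra ℂ G ⧸ I), ρ.IsIrreducible ∧
      Function.Surjective q ∧ (∀ a ∈ I, q a = 0) ∧ ∀ g a, ρ g (q a) = q (single g 1 * a) := by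
  let q : MonoidAlgebra ℂ G →ₗ[ℂ] MonoidAlgebra ℂ G ⧸ I := I.mkQ.restrictScalars ℂ
  let ρ : Representation ℂ G (MonoidAlgebra ℂ G ⧸ I) :=
    Representation.ofModule' (MonoidAlgebra ℂ G ⧸ I)
  have hq : Function.Surjective q := I.mkQ_surjective
  have hker : ∀ a, q a = 0 ↔ a ∈ I := fun a => Submodule.Quotient.mk_eq_zero I
  have hρq : ∀ g a, ρ g (q a) = q (single g 1 * a) := fun g a => rfl
  refine ⟨ρ, q, ?_, hq, fun a => (hker a).mpr, hρq⟩
  have key : ∀ W : Subrepresentation ρ, W = ⊥ ∨ W = ⊤ := by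
    intro W
    let J : Ideal (MonoidAlgebra ℂ G) :=
      { carrier := {a | q a ∈ W.toSubmodule}
        zero_mem' := by simp
        add_mem' := fun {a b} ha hb => by
          change q (a + b) ∈ W.toSubmodule
          rw [map_add]
          exact add_mem ha hb
        smul_mem' := fun c a ha => by
          change q (c * a) ∈ W.toSubmodule
          replace ha : q a ∈ W.toSubmodule := ha
          induction c using MonoidAlgebra.induction_linear with
          | zero => simp
          | add c d hc hd =>
            rw [add_mul, map_add]
            exact add_mem hc hd
          | single g r =>
            have h4 : (single g r : MonoidAlgebra ℂ G) = r • single g 1 := by simp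
            rw [h4, smul_mul_assoc, map_smul, ← hρq]
            exact Submodule.smul_mem _ _ (W.apply_mem_toSubmodule g ha) }
    have hIJ : I ≤ J := fun a ha => by
      change q a ∈ W.toSubmodule
      rw [(hker a).mpr ha]
      exact zero_mem _
    rcases (Ideal.isMaximal_def.mp hI).le_iff.mp hIJ with h | h
    · right
      apply Subrepresentation.toSubmodule_injective
      refine eq_top_iff.mpr fun v _ => ?_
      obtain ⟨a, rfl⟩ := hq v
      have : a ∈ J := h ▸ Submodule.mem_top
      exact this
    · left
      apply Subrepresentation.toSubmodule_injective
      refine eq_bot_iff.mpr fun v hv => ?_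
      obtain ⟨a, rfl⟩ := hq v
      have : a ∈ J := hv
      rw [h] at this
      exact (hker a).mpr this
  have hne : (⊥ : Subrepresentation ρ) ≠ ⊤ := by
    intro h
    have h1 : q 1 ∈ (⊤ : Subrepresentation ρ).toSubmodule := Submodule.mem_top
    rw [← h] at h1
    exact hI.ne_top ((Ideal.eq_top_iff_one I).mpr ((hker 1).mp h1))
  exact { exists_pair_ne := ⟨⊥, ⊤, hne⟩, eq_bot_or_eq_top := key }

variable [Fintype G]

theorem sum_conj_comm {S : Type*} [Semiring S] (f : G →* S) (y g : G) :
    (∑ h, f (h * y * h⁻¹)) * f g = f g * ∑ h, f (h * y * h⁻¹) := by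
  rw [Finset.sum_mul, Finset.mul_sum, ← Equiv.sum_comp (Equiv.mulLeft g)]
  refine Finset.sum_congr rfl fun h _ => ?_
  rw [← map_mul, ← map_mul]
  simp [mul_assoc]

/-- By Schur's lemma the sum of the conjugates of `y` acts as a scalar, which its trace determines;
the trace of its product with `ρ x` is then the averaging identity. -/
theorem exists_isSpherical_of_mem_Irr {χ : G → ℂ} (hχ : χ ∈ Irr G) :
    ∃ (n : ℕ) (φ : G → ℂ), n ≠ 0 ∧ IsSpherical φ ∧ ∀ g, χ g = n * φ g := by
  obtain ⟨V, _, _, _, ρ, hρ, rfl⟩ := hχ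
  have hV : Nontrivial V := by
    have := (Representation.irreducible_iff_isSimpleModule_asModule ρ).mp hρ
    exact IsSimpleModule.nontrivial (MonoidAlgebra ℂ G) ρ.asModule
  have hn : Module.finrank ℂ V ≠ 0 := Module.finrank_pos.ne'
  have hn' : (Module.finrank ℂ V : ℂ) ≠ 0 := Nat.cast_ne_zero.mpr hn
  refine ⟨Module.finrank ℂ V, fun g => ρ.character g / Module.finrank ℂ V, hn, ⟨?_, ?_⟩, ?_⟩
  · simp [hn']
  · intro x y
    obtain ⟨c, hc⟩ := exists_eq_smul_one_of_commute ρ hρ (∑ h, ρ (h * y * h⁻¹))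
      fun g => sum_conj_comm (S := Module.End ℂ V) ρ y g
    have h1 : (Fintype.card G : ℂ) * ρ.character y = c * Module.finrank ℂ V := by
      have := congrArg (LinearMap.trace ℂ V) hc
      rw [map_sum, map_smul, LinearMap.trace_id] at this
      have h2 : ∀ h, LinearMap.trace ℂ V (ρ (h * y * h⁻¹)) = ρ.character y :=
        fun h => ρ.char_conj y h
      simpa only [h2, Finset.sum_const, Finset.card_univ, nsmul_eq_mul, smul_eq_mul] using this
    have h3 : ∑ h, ρ.character (x * (h * y * h⁻¹)) = c * ρ.character x := by
      have := congrArg (fun T => LinearMap.trace ℂ V (ρ x * T)) hc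
      simp only [Finset.mul_sum, map_sum, ← map_mul] at this
      rw [mul_smul_comm, map_smul] at this
      exact this
    rw [← Finset.sum_div, h3]
    field_simp
    linear_combination (-ρ.character x) * h1
  · intro g
    field_simp

/-- The left kernel `N` of the form defined by `φ` is a proper left ideal containing every central
element `T - |G| φ(y)`, where `T` sums the conjugates of `y`. On the simple quotient by a maximal
left ideal above `N`, `T` is therefore the scalar `|G| φ(y)`, and traces give the character. -/
theorem exists_mem_Irr_of_isSpherical {φ : G → ℂ} (hφ : IsSpherical φ) :
    ∃ (n : ℕ) (χ : G → ℂ), n ≠ 0 ∧ χ ∈ Irr G ∧ ∀ g, χ g = n * φ g := by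
  let N : Ideal (MonoidAlgebra ℂ G) :=
    { carrier := {a | ∀ b, linExt ℂ φ (b * a) = 0}
      zero_mem' := fun b => by simp
      add_mem' := fun {a a'} ha ha' b => by rw [mul_add, map_add, ha b, ha' b, add_zero]
      smul_mem' := fun c a ha b => by rw [smul_eq_mul, ← mul_assoc]; exact ha _ }
  have hN : N ≠ ⊤ := by
    intro h
    have h1 : (1 : MonoidAlgebra ℂ G) ∈ N := h ▸ Submodule.mem_top
    have h2 : linExt ℂ φ (1 * 1) = 0 := h1 1
    rw [mul_one, one_def, linExt_single, hφ.map_one] at h2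
    simp at h2
  obtain ⟨I, hI, hNI⟩ := Ideal.exists_le_maximal N hN
  obtain ⟨ρ, q, hρ, hq, hker, hρq⟩ := exists_representation_quotient I hI
  have : FiniteDimensional ℂ (MonoidAlgebra ℂ G ⧸ I) := Module.Finite.of_surjective q hq
  have hV : Nontrivial (MonoidAlgebra ℂ G ⧸ I) := Submodule.Quotient.nontrivial_iff.mpr hI.ne_top
  refine ⟨Module.finrank ℂ (MonoidAlgebra ℂ G ⧸ I), ρ.character, Module.finrank_pos.ne',
    character_mem_Irr ρ hρ, ?_⟩
  intro y
  have hsum : ∑ h, ρ (h * y * h⁻¹) = ((Fintype.card G : ℂ) * φ y) • LinearMap.id := by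
    refine LinearMap.ext fun m => ?_
    obtain ⟨a, rfl⟩ := hq m
    rw [LinearMap.sum_apply]
    simp only [hρq]
    rw [← map_sum, LinearMap.smul_apply, LinearMap.id_apply, ← map_smul, ← Finset.sum_mul,
      ← sub_eq_zero, ← map_sub]
    set T : MonoidAlgebra ℂ G := ∑ h, single (h * y * h⁻¹) 1 with hT
    have hTg : ∀ g : G, single g 1 * T = T * single g 1 := fun g =>
      (sum_conj_comm (MonoidAlgebra.of ℂ G) y g).symm
    have hTa : T * a = a * T := by
      induction a using MonoidAlgebra.induction_linear with
      | zero => simp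
      | add a b ha hb => rw [mul_add, add_mul, ha, hb]
      | single g r =>
        have h4 : (single g r : MonoidAlgebra ℂ G) = r • single g 1 := by simp
        rw [h4, mul_smul_comm, smul_mul_assoc, hTg]
    have hTφ : linExt ℂ φ T = Fintype.card G * φ y := by
      rw [hT, map_sum]
      simp [hφ.conj]
    have hmem : T - algebraMap ℂ _ ((Fintype.card G : ℂ) * φ y) ∈ N := fun b => by
      rw [mul_sub, map_sub, hφ.linExt_mul b T hTg, ← Algebra.commutes, ← Algebra.smul_def,
        map_smul, hTφ, smul_eq_mul]
      ring
    have hmem2 : T * a - ((Fintype.card G : ℂ) * φ y) • a ∈ I := by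
      have := I.mul_mem_left a (hNI hmem)
      rwa [mul_sub, ← Algebra.commutes, ← Algebra.smul_def, ← hTa] at this
    exact hker _ hmem2
  have h1 := congrArg (LinearMap.trace ℂ (MonoidAlgebra ℂ G ⧸ I)) hsum
  rw [map_sum, map_smul, LinearMap.trace_id] at h1
  have h2 : ∀ h, LinearMap.trace ℂ (MonoidAlgebra ℂ G ⧸ I) (ρ (h * y * h⁻¹)) = ρ.character y :=
    fun h => ρ.char_conj y h
  simp only [h2, Finset.sum_const, Finset.card_univ, nsmul_eq_mul, smul_eq_mul] at h1
  apply mul_left_cancel₀ (card_ne_zero_complex G)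
  rw [h1]
  ring

end Irr

/-! ### The centre of the group algebra -/

section Center

variable {G : Type*} [Group G]

theorem mem_center_iff_forall_single {k : Type*} [CommRing k] {z : MonoidAlgebra k G} :
    z ∈ Subalgebra.center k (MonoidAlgebra k G) ↔ ∀ h : G, single h 1 * z = z * single h 1 := by
  rw [Subalgebra.mem_center_iff]
  refine ⟨fun h g => h _, fun h a => ?_⟩
  induction a using MonoidAlgebra.induction_linear with
  | zero => simp
  | add a b ha hb => rw [mul_add, add_mul, ha, hb]
  | single g r =>
    have h4 : (single g r : MonoidAlgebra k G) = r • single g 1 := by simp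
    rw [h4, mul_smul_comm, smul_mul_assoc, h]

/-! ### The antipode as a positive definite involution -/

section Antipode

variable {k : Type*} [CommRing k]

theorem coeff_antipode (a : MonoidAlgebra k G) (g : G) :
    (HopfAlgebra.antipode k a).coeff g = a.coeff g⁻¹ := by
  classical
  induction a using MonoidAlgebra.induction_linear with
  | zero => simp
  | add a b ha hb => simp [ha, hb]
  | single h r => simp [MonoidAlgebra.antipode_single, Finsupp.single_apply, inv_eq_iff_eq_inv]

theorem antipode_antipode_apply (a : MonoidAlgebra k G) :
    HopfAlgebra.antipode k (HopfAlgebra.antipode k a) = a := by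
  ext g
  simp [coeff_antipode]

theorem antipode_mem_center {z : MonoidAlgebra k G}
    (hz : z ∈ Subalgebra.center k (MonoidAlgebra k G)) :
    HopfAlgebra.antipode k z ∈ Subalgebra.center k (MonoidAlgebra k G) := by
  rw [Subalgebra.mem_center_iff] at hz ⊢
  intro a
  rw [← antipode_antipode_apply a, ← HopfAlgebra.antipode_mul_antidistrib, ← HopfAlgebra.antipode_mul_antidistrib, hz]

/-- This positivity is used twice: over `ℚ` it makes the centre reduced, over `ℤ` it forces `a = ±g`
when `a a* = 1`. -/
theorem coeff_one_mul_antipode [Fintype G] (a : MonoidAlgebra k G) :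
    (a * HopfAlgebra.antipode k a).coeff 1 = ∑ g, a.coeff g ^ 2 := by
  rw [coeff_mul_apply_left, Finsupp.sum_fintype _ _ (by simp)]
  exact Finset.sum_congr rfl fun g _ => by simp [coeff_antipode, sq]

theorem eq_zero_of_mul_antipode_eq_zero [Fintype G] {a : MonoidAlgebra ℚ G}
    (h : a * HopfAlgebra.antipode ℚ a = 0) : a = 0 := by
  have h1 := coeff_one_mul_antipode a
  rw [h, coeff_zero, Finsupp.coe_zero, Pi.zero_apply] at h1
  ext g
  have := (Finset.sum_eq_zero_iff_of_nonneg (fun g _ => sq_nonneg (a.coeff g))).mp h1.symm g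
    (Finset.mem_univ g)
  simpa using this

end Antipode

instance [Fintype G] : IsReduced (Subalgebra.center ℚ (MonoidAlgebra ℚ G)) := by
  rw [isReduced_iff_pow_one_lt 2 one_lt_two]
  rintro ⟨z, hz⟩ h
  have hzz : z * z = 0 := by simpa [sq] using congrArg Subtype.val h
  have hS := antipode_mem_center hz
  rw [Subalgebra.mem_center_iff] at hz
  -- With `w = z z*` and `z` central, `w w* = z² (z*)² = 0`; positivity gives `w = 0`, then `z = 0`.
  refine Subtype.ext (eq_zero_of_mul_antipode_eq_zero (eq_zero_of_mul_antipode_eq_zero ?_))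
  change z * HopfAlgebra.antipode ℚ z * HopfAlgebra.antipode ℚ (z * HopfAlgebra.antipode ℚ z) = 0
  rw [HopfAlgebra.antipode_mul_antidistrib, antipode_antipode_apply, ← hz (HopfAlgebra.antipode ℚ z), mul_assoc,
    hz (HopfAlgebra.antipode ℚ z), ← mul_assoc z z, hzz]
  simp

variable [Fintype G]

instance : IsArtinianRing (Subalgebra.center ℚ (MonoidAlgebra ℚ G)) :=
  IsArtinianRing.of_finite ℚ _

/-- The algebra homomorphism from the centre of the group algebra defined by a spherical
function. -/
def centerHom (k : Type*) [CommRing k] [Algebra k ℂ] {φ : G → ℂ} (hφ : IsSpherical φ) :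
    Subalgebra.center k (MonoidAlgebra k G) →ₐ[k] ℂ :=
  AlgHom.ofLinearMap ((linExt k φ).comp (Subalgebra.center k (MonoidAlgebra k G)).val.toLinearMap)
    (by simp [one_def, hφ.map_one])
    (fun a b => hφ.linExt_mul a.1 b.1 (mem_center_iff_forall_single.mp b.2))

/-- The average of the conjugates of `g` in the rational group algebra. -/
def classAverage (g : G) : Subalgebra.center ℚ (MonoidAlgebra ℚ G) :=
  (Fintype.card G : ℚ)⁻¹ • ⟨∑ h, single (h * g * h⁻¹) 1, mem_center_iff_forall_single.mpr
    fun x => (sum_conj_comm (MonoidAlgebra.of ℚ G) g x).symm⟩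

theorem card_smul_classAverage (g : G) :
    (Fintype.card G : ℚ) • (classAverage g : MonoidAlgebra ℚ G) =
      ∑ h, single (h * g * h⁻¹) 1 := by
  have : (Fintype.card G : ℚ) ≠ 0 := Nat.cast_ne_zero.mpr Fintype.card_ne_zero
  simp [classAverage, this]

theorem centerHom_classAverage {φ : G → ℂ} (hφ : IsSpherical φ) (g : G) :
    centerHom ℚ hφ (classAverage g) = φ g := by
  have h := congrArg (linExt ℚ φ) (card_smul_classAverage g)
  rw [map_smul, map_sum] at h
  simp only [linExt_single, hφ.conj, Finset.sum_const, Finset.card_univ, one_smul, nsmul_eq_mul,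
    Rat.smul_def, Rat.cast_natCast] at h
  exact mul_left_cancel₀ (card_ne_zero_complex G) h

theorem classAverage_one : classAverage (1 : G) = 1 := by
  have : (Fintype.card G : ℚ) ≠ 0 := Nat.cast_ne_zero.mpr Fintype.card_ne_zero
  apply Subtype.ext
  apply smul_right_injective _ this
  change (Fintype.card G : ℚ) • (classAverage (1 : G) : MonoidAlgebra ℚ G) = _
  rw [card_smul_classAverage]
  simp [one_def]

/-- A central element is the combination of class averages given by its coefficients. -/
theorem eq_sum_classAverage (z : Subalgebra.center ℚ (MonoidAlgebra ℚ G)) :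
    z = ∑ g, z.1.coeff g • classAverage g := by
  have hn : (Fintype.card G : ℚ) ≠ 0 := Nat.cast_ne_zero.mpr Fintype.card_ne_zero
  -- Averaging over conjugation sends each `g` to its class average and fixes central elements.
  have key : ∀ a : MonoidAlgebra ℚ G, ∑ h : G, single h 1 * a * single h⁻¹ 1 =
      (Fintype.card G : ℚ) • ∑ g, a.coeff g • (classAverage g : MonoidAlgebra ℚ G) := by
    classical
    intro a
    induction a using MonoidAlgebra.induction_linear with
    | zero => simp
    | add a b ha hb =>
      simp only [mul_add, add_mul, Finset.sum_add_distrib, ha, hb, coeff_add, Finsupp.add_apply,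
        add_smul, smul_add]
    | single x r =>
      have h1 : ∑ g, (single x r : MonoidAlgebra ℚ G).coeff g •
          (classAverage g : MonoidAlgebra ℚ G) = r • (classAverage x : MonoidAlgebra ℚ G) := by
        simp [Finsupp.single_apply, ite_smul]
      rw [h1, smul_comm, card_smul_classAverage, Finset.smul_sum]
      simp [single_mul_single]
  have h2 : ∀ h : G, single h (1 : ℚ) * z.1 * single h⁻¹ 1 = z.1 := fun h => by
    rw [mem_center_iff_forall_single.mp z.2, mul_assoc, single_mul_single, mul_inv_cancel, mul_one,
      ← one_def, mul_one]
  have h3 := key z.1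
  simp only [h2, Finset.sum_const, Finset.card_univ] at h3
  apply Subtype.ext
  apply smul_right_injective _ hn
  simp only [← Nat.cast_smul_eq_nsmul ℚ] at h3
  refine h3.trans ?_
  simp

/-- Class averages satisfy the averaging identity themselves, so every algebra homomorphism from the
centre to `ℂ` yields a spherical function. -/
theorem classAverage_mul (x y : G) :
    (Fintype.card G : ℚ) • (classAverage x * classAverage y) =
      ∑ h, classAverage (x * (h * y * h⁻¹)) := by
  have hn : (Fintype.card G : ℚ) ≠ 0 := Nat.cast_ne_zero.mpr Fintype.card_ne_zero
  apply Subtype.ext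
  apply smul_right_injective _ hn
  simp only [Subalgebra.coe_smul, Subalgebra.coe_mul, AddSubmonoidClass.coe_finsetSum,
    Finset.smul_sum, card_smul_classAverage]
  rw [← mul_smul_comm, ← smul_mul_assoc, card_smul_classAverage, card_smul_classAverage,
    Finset.sum_mul_sum]
  conv_rhs => rw [Finset.sum_comm]
  refine Finset.sum_congr rfl fun k _ => ?_
  rw [← Equiv.sum_comp (Equiv.mulLeft k)]
  refine Finset.sum_congr rfl fun h _ => ?_
  simp [single_mul_single, mul_assoc]

/-- A complex point of the centre of the rational group algebra defines a spherical function. -/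
theorem isSpherical_of_algHom (f : Subalgebra.center ℚ (MonoidAlgebra ℚ G) →ₐ[ℚ] ℂ) :
    IsSpherical fun g => f (classAverage g) := by
  refine ⟨by rw [classAverage_one, map_one], fun x y => ?_⟩
  rw [← map_sum, ← classAverage_mul, map_smul, map_mul, Rat.smul_def]
  simp

theorem linExt_of_algHom (f : Subalgebra.center ℚ (MonoidAlgebra ℚ G) →ₐ[ℚ] ℂ)
    (z : Subalgebra.center ℚ (MonoidAlgebra ℚ G)) :
    linExt ℚ (fun g => f (classAverage g)) z.1 = f z := by
  conv_rhs => rw [eq_sum_classAverage z]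
  simp [linExt_apply]

/-- Spherical functions separate the elements of the centre of the rational group algebra. -/
theorem eq_zero_of_forall_linExt_eq_zero (z : Subalgebra.center ℚ (MonoidAlgebra ℚ G))
    (h : ∀ φ : G → ℂ, IsSpherical φ → linExt ℚ φ z.1 = 0) : z = 0 := by
  -- A reduced Artinian ring is the product of its residue fields. Each is finite over `ℚ`, so
  -- embeds in `ℂ`, and the resulting point is a spherical function.
  apply (IsArtinianRing.equivPi (Subalgebra.center ℚ (MonoidAlgebra ℚ G))).injective
  rw [map_zero]
  funext m
  rw [IsArtinianRing.equivPi_apply, Pi.zero_apply]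
  let _ : Field (Subalgebra.center ℚ (MonoidAlgebra ℚ G) ⧸ m.asIdeal) := Ideal.Quotient.field _
  have : Algebra.IsAlgebraic ℚ (Subalgebra.center ℚ (MonoidAlgebra ℚ G) ⧸ m.asIdeal) :=
    Algebra.IsAlgebraic.of_finite _ _
  let j : (Subalgebra.center ℚ (MonoidAlgebra ℚ G) ⧸ m.asIdeal) →ₐ[ℚ] ℂ := IsAlgClosed.lift
  let f := j.comp (Ideal.Quotient.mkₐ ℚ m.asIdeal)
  have h1 := h _ (isSpherical_of_algHom f)
  rw [linExt_of_algHom] at h1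
  exact (map_eq_zero_iff j j.toRingHom.injective).mp h1

end Center

/-! ### Imaginary quadratic fields -/

section Fields

/-- The subfield `K` of `ℂ` is `ℚ` or imaginary quadratic. -/
def IsRatOrImagQuad (K : IntermediateField ℚ ℂ) : Prop :=
  K = ⊥ ∨ ∃ d : ℕ, 0 < d ∧ K = imagQuadField d

/-- The generator `√-d` of the field `ℚ(√-d)`. -/
def sqrtNeg (d : ℕ) : ℂ := ((Real.sqrt d : ℝ) : ℂ) * Complex.I

theorem sqrtNeg_mul_self (d : ℕ) : sqrtNeg d * sqrtNeg d = -(d : ℂ) := by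
  have h : ((Real.sqrt d : ℝ) : ℂ) * ((Real.sqrt d : ℝ) : ℂ) = d := by
    rw [← Complex.ofReal_mul, Real.mul_self_sqrt (Nat.cast_nonneg d), Complex.ofReal_natCast]
  calc sqrtNeg d * sqrtNeg d
      = (((Real.sqrt d : ℝ) : ℂ) * ((Real.sqrt d : ℝ) : ℂ)) * (Complex.I * Complex.I) := by
        unfold sqrtNeg; ring
    _ = _ := by rw [h, Complex.I_mul_I]; ring

theorem sqrtNeg_mem (d : ℕ) : sqrtNeg d ∈ imagQuadField d :=
  IntermediateField.mem_adjoin_simple_self ℚ _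

theorem ratCast_mem (K : IntermediateField ℚ ℂ) (q : ℚ) : (q : ℂ) ∈ K := by
  simp

theorem star_sqrtNeg (d : ℕ) : starRingEnd ℂ (sqrtNeg d) = -sqrtNeg d := by
  simp [sqrtNeg]

theorem exists_eq_add_mul_sqrtNeg {d : ℕ} {z : ℂ} (hz : z ∈ imagQuadField d) :
    ∃ a b : ℚ, z = a + b * sqrtNeg d := by
  induction hz using IntermediateField.adjoin_induction with
  | mem x hx => exact ⟨0, 1, by simpa [sqrtNeg] using hx⟩
  | algebraMap q => exact ⟨q, 0, by simp⟩
  | add x y _ _ hx hy =>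
    obtain ⟨a, b, rfl⟩ := hx
    obtain ⟨a', b', rfl⟩ := hy
    exact ⟨a + a', b + b', by push_cast; ring⟩
  | mul x y _ _ hx hy =>
    obtain ⟨a, b, rfl⟩ := hx
    obtain ⟨a', b', rfl⟩ := hy
    refine ⟨a * a' - b * b' * d, a * b' + a' * b, ?_⟩
    push_cast
    linear_combination (b * b' : ℂ) * sqrtNeg_mul_self d
  | inv x _ hx =>
    obtain ⟨a, b, rfl⟩ := hx
    have h : ((a : ℂ) + b * sqrtNeg d) * (a - b * sqrtNeg d) = ((a ^ 2 + b ^ 2 * d : ℚ) : ℂ) := by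
      push_cast
      linear_combination (-b ^ 2 : ℂ) * sqrtNeg_mul_self d
    by_cases h0 : (a : ℂ) + b * sqrtNeg d = 0
    · exact ⟨0, 0, by simp [h0]⟩
    · refine ⟨a / (a ^ 2 + b ^ 2 * d), -b / (a ^ 2 + b ^ 2 * d), ?_⟩
      -- The two factors of the norm are complex conjugates, so neither can vanish alone.
      have h1 : ((a ^ 2 + b ^ 2 * d : ℚ) : ℂ) ≠ 0 := by
        intro h2
        rw [h2, mul_eq_zero] at h
        have h3 := h.resolve_left h0
        have h4 : starRingEnd ℂ ((a : ℂ) - b * sqrtNeg d) = a + b * sqrtNeg d := by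
          rw [map_sub, map_mul, star_sqrtNeg]
          simp
        rw [h3, map_zero] at h4
        exact h0 h4.symm
      rw [inv_eq_iff_eq_inv, ← mul_right_inj' h1]
      have h5 : ((a / (a ^ 2 + b ^ 2 * d) : ℚ) : ℂ) + ((-b / (a ^ 2 + b ^ 2 * d) : ℚ) : ℂ) *
          sqrtNeg d = (a - b * sqrtNeg d) / ((a ^ 2 + b ^ 2 * d : ℚ) : ℂ) := by
        push_cast
        ring
      have h6 : (a : ℂ) - b * sqrtNeg d ≠ 0 := by
        intro h7
        rw [h7, mul_zero] at h
        exact h1 h.symm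
      rw [h5, inv_div, ← h]
      field_simp

/-- This is the property of these fields that the cut criterion uses: `|z|²` is rational for every
element `z`. -/
theorem exists_conj_mul_self_eq_ratCast {K : IntermediateField ℚ ℂ} (hK : IsRatOrImagQuad K)
    {z : ℂ} (hz : z ∈ K) : ∃ q : ℚ, z * starRingEnd ℂ z = q := by
  rcases hK with rfl | ⟨d, -, rfl⟩
  · obtain ⟨q, rfl⟩ := IntermediateField.mem_bot.mp hz
    exact ⟨q * q, by simp⟩
  · obtain ⟨a, b, rfl⟩ := exists_eq_add_mul_sqrtNeg hz
    refine ⟨a ^ 2 + b ^ 2 * d, ?_⟩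
    rw [map_add, map_mul, star_sqrtNeg]
    push_cast
    simp only [map_ratCast]
    linear_combination (-b ^ 2 : ℂ) * sqrtNeg_mul_self d

theorem imagQuadField_le {d : ℕ} {K : IntermediateField ℚ ℂ} (h : sqrtNeg d ∈ K) :
    imagQuadField d ≤ K :=
  IntermediateField.adjoin_simple_le_iff.mpr h

theorem eq_bot_or_eq_of_le_imagQuadField {d : ℕ} {K : IntermediateField ℚ ℂ}
    (h : K ≤ imagQuadField d) : K = ⊥ ∨ K = imagQuadField d := by
  by_cases hK : sqrtNeg d ∈ K
  · exact Or.inr (le_antisymm h (imagQuadField_le hK))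
  · refine Or.inl (eq_bot_iff.mpr fun z hz => ?_)
    obtain ⟨a, b, rfl⟩ := exists_eq_add_mul_sqrtNeg (h hz)
    have hb : b = 0 := by
      by_contra hb
      have hb' : (b : ℂ) ≠ 0 := Rat.cast_ne_zero.mpr hb
      have h1 : sqrtNeg d = (b : ℂ)⁻¹ * ((a + b * sqrtNeg d) - a) := by
        field_simp
        ring
      rw [h1] at hK
      exact hK (K.mul_mem (K.inv_mem (ratCast_mem K b)) (K.sub_mem hz (ratCast_mem K a)))
    rw [hb]
    simp

theorem sqrtNeg_im_ne_zero {d : ℕ} (hd : 0 < d) : (sqrtNeg d).im ≠ 0 := by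
  have : Real.sqrt d ≠ 0 := (Real.sqrt_pos.mpr (Nat.cast_pos.mpr hd)).ne'
  simpa [sqrtNeg] using this

theorem imagQuadField_ne_bot {d : ℕ} (hd : 0 < d) : imagQuadField d ≠ ⊥ := by
  intro h
  have h1 := sqrtNeg_mem d
  rw [h] at h1
  obtain ⟨q, hq⟩ := IntermediateField.mem_bot.mp h1
  apply sqrtNeg_im_ne_zero hd
  rw [← hq]
  simp

/-- A complex number that is not real and whose square is rational generates an imaginary
quadratic field. -/
theorem exists_sqrtNeg_eq {t : ℂ} (ht : t.im ≠ 0) {q : ℚ} (hq : t * t = q) :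
    ∃ (d : ℕ) (c : ℚ), 0 < d ∧ sqrtNeg d = c * t := by
  have hre : t.re = 0 := by
    have := congrArg Complex.im hq
    simp only [Complex.mul_im, Complex.ratCast_im] at this
    have h2 : t.re * t.im = 0 := by linarith
    exact (mul_eq_zero.mp h2).resolve_right ht
  have him : t.im * t.im = ((-q : ℚ) : ℝ) := by
    have := congrArg Complex.re hq
    simp only [Complex.mul_re, Complex.ratCast_re, hre] at this
    push_cast
    linarith
  have hpos : 0 < -q := by
    have : (0 : ℝ) < ((-q : ℚ) : ℝ) := him ▸ mul_self_pos.mpr ht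
    exact_mod_cast this
  obtain ⟨r, hr⟩ : ∃ r : ℚ, r = -q := ⟨_, rfl⟩
  rw [← hr] at him hpos
  have hn : 0 < r.num := Rat.num_pos.mpr hpos
  -- Write `-q = p / r.den`; then `d = p * r.den` is a natural number with `√d = r.den * |t.im|`,
  -- and the sign of `t.im` decides that of `c`.
  obtain ⟨p, hp⟩ := Int.eq_ofNat_of_zero_le hn.le
  have hp0 : 0 < p := by omega
  have hrd : (r : ℝ) * r.den = p := by
    have := Rat.mul_den_eq_num r
    rw [hp] at this
    exact_mod_cast this
  have hsq : ((p * r.den : ℕ) : ℝ) = (r.den * |t.im|) ^ 2 := by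
    rw [mul_pow, sq_abs, sq t.im, him]
    push_cast
    rw [← hrd]
    ring
  have hsqrt : Real.sqrt ((p * r.den : ℕ) : ℝ) = r.den * |t.im| := by
    rw [hsq, Real.sqrt_sq (by positivity)]
  have ht' : t = t.im * Complex.I := by
    apply Complex.ext <;> simp [hre]
  rcases abs_choice t.im with h | h
  · refine ⟨p * r.den, r.den, Nat.mul_pos hp0 r.den_pos, ?_⟩
    rw [sqrtNeg, hsqrt, h]
    conv_rhs => rw [ht']
    push_cast
    ring
  · refine ⟨p * r.den, -r.den, Nat.mul_pos hp0 r.den_pos, ?_⟩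
    rw [sqrtNeg, hsqrt, h]
    conv_rhs => rw [ht']
    push_cast
    ring

theorem isRatOrImagQuad_of_finrank {K : IntermediateField ℚ ℂ}
    (h : Module.finrank ℚ K = 1 ∨ (Module.finrank ℚ K = 2 ∧ ∃ z ∈ K, z.im ≠ 0)) :
    IsRatOrImagQuad K := by
  rcases h with h | ⟨h, z, hz, hzi⟩
  · exact Or.inl (IntermediateField.finrank_eq_one_iff.mp h)
  · right
    have : FiniteDimensional ℚ K := Module.finite_of_finrank_pos (by omega)
    obtain ⟨a, b, c, hne, habc⟩ : ∃ a b c : ℚ, (a ≠ 0 ∨ b ≠ 0 ∨ c ≠ 0) ∧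
        (a : ℂ) + b * z + c * (z * z) = 0 := by
      have hdep : ¬ LinearIndependent ℚ ![(1 : K), ⟨z, hz⟩, ⟨z, hz⟩ * ⟨z, hz⟩] := fun hli => by
        have := hli.fintype_card_le_finrank
        simp [h] at this
      rw [Fintype.not_linearIndependent_iff] at hdep
      obtain ⟨g, hg, i, hi⟩ := hdep
      refine ⟨g 0, g 1, g 2, ?_, ?_⟩
      · fin_cases i
        · exact Or.inl hi
        · exact Or.inr (Or.inl hi)
        · exact Or.inr (Or.inr hi)
      · have := congrArg (fun x : K => (x : ℂ)) hg
        simpa [Fin.sum_univ_three, Algebra.smul_def] using this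
    have hc : c ≠ 0 := by
      rintro rfl
      have hb : b = 0 := by
        have := congrArg Complex.im habc
        simpa [hzi] using this
      subst hb
      simp at habc
      simp [habc] at hne
    have hc' : (c : ℂ) ≠ 0 := Rat.cast_ne_zero.mpr hc
    -- Completing the square in the quadratic relation for `z`.
    obtain ⟨d, e, hd, hde⟩ := exists_sqrtNeg_eq (t := z + ((b / (2 * c) : ℚ) : ℂ))
      (by rwa [Complex.add_im, Complex.ratCast_im, add_zero]) (q := (b / (2 * c)) ^ 2 - a / c) (by
        push_cast
        field_simp
        linear_combination (4 * c) * habc)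
    have hle : imagQuadField d ≤ K := imagQuadField_le (by
      rw [hde]
      exact K.mul_mem (ratCast_mem K e) (K.add_mem hz (ratCast_mem K _)))
    refine ⟨d, hd, (IntermediateField.eq_of_le_of_finrank_le hle ?_).symm⟩
    have : FiniteDimensional ℚ (imagQuadField d) :=
      FiniteDimensional.of_injective (IntermediateField.inclusion hle).toLinearMap
        (IntermediateField.inclusion hle).toRingHom.injective
    have h0 : 0 < Module.finrank ℚ (imagQuadField d) := Module.finrank_pos
    have h1 : Module.finrank ℚ (imagQuadField d) ≠ 1 := fun h1 =>
      imagQuadField_ne_bot hd (IntermediateField.finrank_eq_one_iff.mp h1)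
    omega

open NumberField in
/-- A number field all of whose units are torsion is `ℚ` or imaginary quadratic. -/
theorem finrank_of_units_torsion {K : Type*} [Field K] [NumberField K]
    (h : ∀ v : (𝓞 K)ˣ, IsOfFinOrder v) (σ : K →+* ℂ) :
    Module.finrank ℚ K = 1 ∨ (Module.finrank ℚ K = 2 ∧ ∃ x, (σ x).im ≠ 0) := by
  -- A fundamental unit has nonzero logarithm, being a basis vector of the unit lattice, so it
  -- cannot be torsion.
  have hrank : Units.rank K = 0 := by
    by_contra h0
    let i : Fin (Units.rank K) := ⟨0, Nat.pos_of_ne_zero h0⟩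
    have h1 := Units.logEmbedding_fundSystem K i
    rw [Units.dirichletUnitTheorem.logEmbedding_eq_zero_iff.mpr (h _)] at h1
    exact (Units.basisUnitLattice K).ne_zero i (Subtype.ext h1.symm)
  have hcard := InfinitePlace.card_eq_nrRealPlaces_add_nrComplexPlaces K
  have hsum := InfinitePlace.card_add_two_mul_card_eq_rank K
  have hpos : 0 < Module.finrank ℚ K := Module.finrank_pos
  unfold Units.rank at hrank
  -- Rank zero means one infinite place, so the degree is 1 or 2; in degree 2 the place is complex,
  -- which excludes a real `σ`.
  by_cases h1 : Module.finrank ℚ K = 1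
  · exact Or.inl h1
  · refine Or.inr ⟨by omega, ?_⟩
    by_contra! hreal
    have hr : InfinitePlace.IsReal (InfinitePlace.mk σ) := ⟨σ, by
      ext x
      exact Complex.conj_eq_iff_im.mpr (hreal x), rfl⟩
    have := nrRealPlaces_eq_zero_iff.mp (by omega : InfinitePlace.nrRealPlaces K = 0)
    exact InfinitePlace.not_isReal_iff_isComplex.mpr
      (IsTotallyComplex.isComplex (InfinitePlace.mk σ)) hr

end Fields

/-! ### Cut groups and fields of spherical functions -/

theorem linExt_mem_charField {G : Type*} [Fintype G] (φ : G → ℂ) (a : MonoidAlgebra ℚ G) :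
    linExt ℚ φ a ∈ charField φ := by
  rw [linExt_apply]
  exact sum_mem fun g _ => (charField φ).smul_mem
    (IntermediateField.subset_adjoin ℚ _ (Set.mem_range_self g))

section Cut

variable {G : Type*} [Group G]

theorem mem_center_units_iff (u : (MonoidAlgebra ℤ G)ˣ) :
    u ∈ Subgroup.center (MonoidAlgebra ℤ G)ˣ ↔
      (u : MonoidAlgebra ℤ G) ∈ Subalgebra.center ℤ (MonoidAlgebra ℤ G) := by
  constructor
  · intro h
    rw [mem_center_iff_forall_single]
    intro g
    let v : (MonoidAlgebra ℤ G)ˣ := Units.map (MonoidAlgebra.of ℤ G) (toUnits g)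
    exact congrArg Units.val (Subgroup.mem_center_iff.mp h v)
  · intro h
    rw [Subgroup.mem_center_iff]
    intro v
    exact Units.ext (Subalgebra.mem_center_iff.mp h v)

theorem of_mem_center_iff {g : G} :
    MonoidAlgebra.of ℤ G g ∈ Subalgebra.center ℤ (MonoidAlgebra ℤ G) ↔
      g ∈ Subgroup.center G := by
  rw [mem_center_iff_forall_single, Subgroup.mem_center_iff]
  refine forall_congr' fun h => ?_
  rw [of_apply, single_mul_single, single_mul_single, single_left_inj (by norm_num)]

theorem isCut_iff : IsCut G ↔ ∀ u : (MonoidAlgebra ℤ G)ˣ,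
    (u : MonoidAlgebra ℤ G) ∈ Subalgebra.center ℤ (MonoidAlgebra ℤ G) →
      ∃ g : G, (u : MonoidAlgebra ℤ G) = MonoidAlgebra.of ℤ G g ∨
        (u : MonoidAlgebra ℤ G) = -MonoidAlgebra.of ℤ G g := by
  constructor
  · intro h u hu
    have h1 : u ∈ (Subgroup.center (MonoidAlgebra ℤ G)ˣ : Set (MonoidAlgebra ℤ G)ˣ) :=
      (mem_center_units_iff u).mpr hu
    unfold IsCut at h
    rw [h] at h1
    obtain ⟨g, -, hg⟩ := h1
    exact ⟨g, hg⟩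
  · intro h
    refine Set.ext fun u => ⟨fun hu => ?_, ?_⟩
    · have hu' := (mem_center_units_iff u).mp hu
      obtain ⟨g, hg⟩ := h u hu'
      refine ⟨g, ?_, hg⟩
      rw [← of_mem_center_iff]
      rcases hg with hg | hg
      · rwa [← hg]
      · rw [← neg_neg (MonoidAlgebra.of ℤ G g), ← hg]
        exact neg_mem hu'
    · rintro ⟨g, hg, h1 | h1⟩
      · refine (mem_center_units_iff u).mpr ?_
        rw [h1]
        exact of_mem_center_iff.mpr hg
      · refine (mem_center_units_iff u).mpr ?_
        rw [h1]
        exact neg_mem (of_mem_center_iff.mpr hg)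

/-- The embedding of the integral group ring into the rational group algebra. -/
abbrev toRat (G : Type*) [Group G] : MonoidAlgebra ℤ G →+* MonoidAlgebra ℚ G :=
  mapRingHom G (Int.castRingHom ℚ)

theorem toRat_injective : Function.Injective (toRat G) := by
  intro a b h
  ext g
  have := congrArg (fun x : MonoidAlgebra ℚ G => x.coeff g) h
  simpa using this

theorem toRat_mem_center_iff {a : MonoidAlgebra ℤ G} :
    toRat G a ∈ Subalgebra.center ℚ (MonoidAlgebra ℚ G) ↔
      a ∈ Subalgebra.center ℤ (MonoidAlgebra ℤ G) := by
  rw [mem_center_iff_forall_single, mem_center_iff_forall_single]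
  refine forall_congr' fun g => ?_
  have h1 : (single g 1 : MonoidAlgebra ℚ G) = toRat G (single g 1) := by simp
  rw [h1, ← map_mul, ← map_mul, toRat_injective.eq_iff]

variable [Fintype G]

theorem linExt_toRat (φ : G → ℂ) (a : MonoidAlgebra ℤ G) :
    linExt ℚ φ (toRat G a) = linExt ℤ φ a := by
  simp [linExt_apply, Rat.smul_def]

/-- `φ` is a ring homomorphism on the centre of `ℤG`, which is integral over `ℤ`. -/
theorem isIntegral_linExt {φ : G → ℂ} (hφ : IsSpherical φ) {a : MonoidAlgebra ℤ G}
    (ha : a ∈ Subalgebra.center ℤ (MonoidAlgebra ℤ G)) : IsIntegral ℤ (linExt ℤ φ a) := by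
  have h1 : IsIntegral ℤ a := IsIntegral.of_finite ℤ a
  have h2 : IsIntegral ℤ (⟨a, ha⟩ : Subalgebra.center ℤ (MonoidAlgebra ℤ G)) :=
    (isIntegral_algHom_iff (Subalgebra.center ℤ (MonoidAlgebra ℤ G)).val
      Subtype.val_injective).mp h1
  exact h2.map (centerHom ℤ hφ)

theorem linExt_antipode {φ : G → ℂ} (hφ : IsSpherical φ) (a : MonoidAlgebra ℤ G) :
    linExt ℤ φ (HopfAlgebra.antipode ℤ a) = starRingEnd ℂ (linExt ℤ φ a) := by
  rw [linExt_apply, linExt_apply, map_sum, ← Equiv.sum_comp (Equiv.inv G)]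
  refine Finset.sum_congr rfl fun g _ => ?_
  simp [coeff_antipode, hφ.map_inv]

theorem exists_intCast_of_isIntegral {z : ℂ} (hz : IsIntegral ℤ z) {q : ℚ}
    (hq : z * starRingEnd ℂ z = q) : ∃ a : ℤ, 0 ≤ a ∧ z * starRingEnd ℂ z = a := by
  have h1 : IsIntegral ℤ (starRingEnd ℂ z) := hz.map (starRingEnd ℂ).toIntAlgHom
  have h2 : IsIntegral ℤ (algebraMap ℚ ℂ q) := by
    have := hz.mul h1
    rw [hq] at this
    simpa using this
  rw [isIntegral_algebraMap_iff (algebraMap ℚ ℂ).injective] at h2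
  obtain ⟨a, ha⟩ := IsIntegrallyClosed.isIntegral_iff.mp h2
  have h3 : z * starRingEnd ℂ z = a := by
    rw [hq, ← ha]
    simp
  refine ⟨a, ?_, h3⟩
  rw [Complex.mul_conj] at h3
  have h4 : Complex.normSq z = a := by exact_mod_cast h3
  have h5 : (0 : ℝ) ≤ a := h4 ▸ Complex.normSq_nonneg z
  exact_mod_cast h5

/-- If `a * a* = 1` in the integral group ring then `a` is a trivial unit. -/
theorem eq_of_or_neg_of_mul_antipode_eq_one {a : MonoidAlgebra ℤ G}
    (h : a * HopfAlgebra.antipode ℤ a = 1) :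
    ∃ g : G, a = MonoidAlgebra.of ℤ G g ∨ a = -MonoidAlgebra.of ℤ G g := by
  classical
  have h1 := coeff_one_mul_antipode a
  rw [h, coeff_one_one] at h1
  obtain ⟨g, hg⟩ : ∃ g, a.coeff g ≠ 0 := by
    by_contra! h0
    simp [h0] at h1
  -- The squares of the integer coefficients sum to `1`, so exactly one coefficient is nonzero and
  -- it is `±1`.
  have h2 := Finset.add_sum_erase Finset.univ (fun g => a.coeff g ^ 2) (Finset.mem_univ g)
  have h3 : 0 < a.coeff g ^ 2 := by positivity
  have h4 : 0 ≤ ∑ x ∈ Finset.univ.erase g, a.coeff x ^ 2 :=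
    Finset.sum_nonneg fun x _ => sq_nonneg _
  have h5 : a.coeff g ^ 2 = 1 := by omega
  have h6 : ∑ x ∈ Finset.univ.erase g, a.coeff x ^ 2 = 0 := by omega
  have h7 : ∀ x, x ≠ g → a.coeff x = 0 := fun x hx => by
    have := (Finset.sum_eq_zero_iff_of_nonneg (fun x _ => sq_nonneg (a.coeff x))).mp h6 x
      (Finset.mem_erase.mpr ⟨hx, Finset.mem_univ x⟩)
    simpa using this
  have h8 : a = single g (a.coeff g) := by
    ext x
    by_cases hx : x = g
    · simp [hx]
    · simp [h7 x hx, Ne.symm hx]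
  refine ⟨g, ?_⟩
  rcases mul_self_eq_one_iff.mp ((sq _).symm.trans h5) with h9 | h9
  · left
    rw [h8, h9, of_apply]
  · right
    rw [h8, h9, of_apply, single_neg]

/-- For a central unit `u`, the values `|φ(u)|²` and `|φ(u⁻¹)|²` are nonnegative integers with
product `1`. Hence `u u* - 1` is killed by every spherical function. -/
theorem isCut_of_forall_charField
    (h : ∀ φ : G → ℂ, IsSpherical φ → IsRatOrImagQuad (charField φ)) : IsCut G := by
  rw [isCut_iff]
  intro u hu
  apply eq_of_or_neg_of_mul_antipode_eq_one
  have hinv : ((u⁻¹ : (MonoidAlgebra ℤ G)ˣ) : MonoidAlgebra ℤ G) ∈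
      Subalgebra.center ℤ (MonoidAlgebra ℤ G) :=
    (mem_center_units_iff _).mp (inv_mem ((mem_center_units_iff u).mpr hu))
  have hS := antipode_mem_center hu
  have hw : (u : MonoidAlgebra ℤ G) * HopfAlgebra.antipode ℤ (u : MonoidAlgebra ℤ G) - 1 ∈
      Subalgebra.center ℤ (MonoidAlgebra ℤ G) := sub_mem (mul_mem hu hS) (one_mem _)
  have key : ∀ φ : G → ℂ, IsSpherical φ → linExt ℤ φ
      ((u : MonoidAlgebra ℤ G) * HopfAlgebra.antipode ℤ (u : MonoidAlgebra ℤ G) - 1) = 0 := by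
    intro φ hφ
    have hnorm : ∀ a ∈ Subalgebra.center ℤ (MonoidAlgebra ℤ G), ∃ n : ℤ, 0 ≤ n ∧
        linExt ℤ φ a * starRingEnd ℂ (linExt ℤ φ a) = n := fun a ha => by
      have h1 : linExt ℤ φ a ∈ charField φ := by
        rw [← linExt_toRat]
        exact linExt_mem_charField φ _
      obtain ⟨q, hq⟩ := exists_conj_mul_self_eq_ratCast (h φ hφ) h1
      exact exists_intCast_of_isIntegral (isIntegral_linExt hφ ha) hq
    have hone : linExt ℤ φ 1 = 1 := by simp [one_def, hφ.map_one]
    obtain ⟨m, hm0, hm⟩ := hnorm _ hu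
    obtain ⟨n, hn0, hn⟩ := hnorm _ hinv
    have hmul : linExt ℤ φ (u : MonoidAlgebra ℤ G) *
        linExt ℤ φ ((u⁻¹ : (MonoidAlgebra ℤ G)ˣ) : MonoidAlgebra ℤ G) = 1 := by
      rw [← hφ.linExt_mul _ _ (mem_center_iff_forall_single.mp hinv), Units.mul_inv, hone]
    have hmn : (m : ℂ) * n = 1 := by
      rw [← hm, ← hn, mul_mul_mul_comm, hmul, ← map_mul, hmul, map_one, one_mul]
    have hmn' : m * n = 1 := by exact_mod_cast hmn
    have hm1 : m = 1 := Int.eq_one_of_mul_eq_one_right hm0 hmn'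
    rw [map_sub, hφ.linExt_mul _ _ (mem_center_iff_forall_single.mp hS), linExt_antipode hφ, hm,
      hone, hm1]
    simp
  have hz := eq_zero_of_forall_linExt_eq_zero ⟨_, toRat_mem_center_iff.mpr hw⟩ fun φ hφ => by
    rw [linExt_toRat]
    exact key φ hφ
  have hz' := congrArg Subtype.val hz
  have := toRat_injective (hz'.trans (map_zero _).symm)
  exact sub_eq_zero.mp this

end Cut

/-! ### Units of the components of the centre and Dirichlet's theorem -/

section Dirichlet

open NumberField

/-- Units of finite-index congruence subgroups: a power of every unit is congruent to `1`
modulo a given nonzero integer. -/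
theorem exists_pow_eq_one_add_mul {K : Type*} [Field K] [NumberField K] {N : ℤ} (hN : N ≠ 0)
    (v : (𝓞 K)ˣ) : ∃ (M : ℕ) (x : 𝓞 K), 0 < M ∧ ((v ^ M : (𝓞 K)ˣ) : 𝓞 K) = 1 + N * x := by
  let I : Ideal (𝓞 K) := Ideal.span {(N : 𝓞 K)}
  have hI : I ≠ ⊥ := by
    rw [Ne, Ideal.span_singleton_eq_bot]
    exact_mod_cast hN
  have : Finite (𝓞 K ⧸ I) := Ideal.finiteQuotientOfFreeOfNeBot I hI
  refine ⟨Nat.card (𝓞 K ⧸ I)ˣ, ?_⟩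
  have h1 := pow_card_eq_one' (x := Units.map (Ideal.Quotient.mk I).toMonoidHom v)
  rw [← map_pow] at h1
  have h2 : Ideal.Quotient.mk I ((v ^ Nat.card (𝓞 K ⧸ I)ˣ : (𝓞 K)ˣ) : 𝓞 K) =
      Ideal.Quotient.mk I 1 := congrArg Units.val h1
  rw [Ideal.Quotient.eq, Ideal.mem_span_singleton] at h2
  obtain ⟨x, hx⟩ := h2
  exact ⟨x, Nat.card_pos, by rw [← hx]; ring⟩

variable {G : Type*} [Group G] [Fintype G]

/-- An additive map from a ring of integers to the rational group algebra takes values in the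
integral group ring after multiplication by a suitable integer. -/
theorem exists_toRat_eq_zsmul {K : Type*} [Field K] [NumberField K]
    (j : 𝓞 K →+ MonoidAlgebra ℚ G) :
    ∃ N : ℤ, N ≠ 0 ∧ ∀ x, ∃ a : MonoidAlgebra ℤ G, toRat G a = N • j x := by
  let b := RingOfIntegers.basis K
  -- `N` is a common denominator of all coefficients of the images of an integral basis.
  obtain ⟨N, hN⟩ := IsLocalization.exist_integer_multiples_of_finite (nonZeroDivisors ℤ)
    (fun p : Module.Free.ChooseBasisIndex ℤ (𝓞 K) × G => (j (b p.1)).coeff p.2)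
  refine ⟨N, nonZeroDivisors.ne_zero N.2, fun x => ?_⟩
  have hb : ∀ i, ∃ a : MonoidAlgebra ℤ G, toRat G a = (N : ℤ) • j (b i) := fun i => by
    choose c hc using fun g => hN (i, g)
    refine ⟨MonoidAlgebra.ofCoeff (Finsupp.equivFunOnFinite.symm c), ?_⟩
    ext g
    rw [coeff_smul_apply]
    simpa using hc g
  choose a ha using hb
  refine ⟨∑ i, b.repr x i • a i, ?_⟩
  conv_rhs => rw [← b.sum_repr x]
  simp only [map_sum, map_zsmul, Finset.smul_sum, ha]
  exact Finset.sum_congr rfl fun i _ => smul_comm _ _ _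

/-- The units of the number field attached to a maximal ideal of the centre of the rational
group algebra of a cut group are torsion. -/
theorem isOfFinOrder_of_isCut (hG : IsCut G)
    (m : MaximalSpectrum (Subalgebra.center ℚ (MonoidAlgebra ℚ G)))
    {K : Type*} [Field K] [NumberField K]
    (e : K ≃+* (Subalgebra.center ℚ (MonoidAlgebra ℚ G) ⧸ m.asIdeal)) (v : (𝓞 K)ˣ) :
    IsOfFinOrder v := by
  classical
  let E := (IsArtinianRing.equivPi (Subalgebra.center ℚ (MonoidAlgebra ℚ G)))
  -- Both maps place `x` in the component `m`: `j` is additive, with `0` elsewhere, and `s` is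
  -- multiplicative, with `1` elsewhere. Since `s (1 + x) = 1 + j x`, elements congruent to `1`
  -- modulo the denominator `N` of `j` are sent by `s` into `ℤG`.
  let j : 𝓞 K →+ MonoidAlgebra ℚ G :=
    { toFun := fun x => (E.symm (Pi.single m (e x)) : Subalgebra.center ℚ (MonoidAlgebra ℚ G))
      map_zero' := by simp
      map_add' := fun x y => by simp [Pi.single_add] }
  let s : 𝓞 K →* Subalgebra.center ℚ (MonoidAlgebra ℚ G) :=
    { toFun := fun x => E.symm (Pi.mulSingle m (e x))
      map_one' := by simp
      map_mul' := fun x y => by simp [Pi.mulSingle_mul] }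
  have hs : Function.Injective s := fun x y hxy => by
    have h1 := Pi.mulSingle_injective m (E.symm.injective hxy)
    exact RingOfIntegers.ext (e.injective h1)
  have hsj : ∀ x : 𝓞 K, (s (1 + x) : MonoidAlgebra ℚ G) = 1 + j x := fun x => by
    have h1 : (Pi.mulSingle m (e ((1 + x : 𝓞 K) : K)) : ∀ I : MaximalSpectrum
        (Subalgebra.center ℚ (MonoidAlgebra ℚ G)), _ ⧸ I.asIdeal) = 1 + Pi.single m (e x) := by
      funext i
      by_cases hi : i = m
      · subst hi
        simp
      · simp [Pi.mulSingle_eq_of_ne hi, Pi.single_eq_of_ne hi]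
    change ((E.symm (Pi.mulSingle m (e ((1 + x : 𝓞 K) : K))) :
      Subalgebra.center ℚ (MonoidAlgebra ℚ G)) : MonoidAlgebra ℚ G) = _
    rw [h1, map_add, map_one]
    rfl
  obtain ⟨N, hN, hint⟩ := exists_toRat_eq_zsmul j
  have hint' : ∀ x : 𝓞 K, ∃ a : MonoidAlgebra ℤ G, toRat G a = s (1 + N * x) := fun x => by
    obtain ⟨a, ha⟩ := hint x
    refine ⟨1 + a, ?_⟩
    rw [map_add, map_one, ha, hsj, ← map_zsmul, zsmul_eq_mul]
  obtain ⟨M, x, hM, hx⟩ := exists_pow_eq_one_add_mul hN v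
  -- The inverse is congruent to `1` modulo `N` too, so its image is also integral and `a` is a unit
  -- of `ℤG`.
  have hx' : (((v ^ M)⁻¹ : (𝓞 K)ˣ) : 𝓞 K) = 1 + N * (-((v ^ M)⁻¹ : (𝓞 K)ˣ) * x) := by
    have h1 : (((v ^ M)⁻¹ : (𝓞 K)ˣ) : 𝓞 K) * ((v ^ M : (𝓞 K)ˣ) : 𝓞 K) = 1 := Units.inv_mul _
    rw [hx] at h1
    linear_combination h1
  obtain ⟨a, ha⟩ := hint' x
  obtain ⟨b, hb⟩ := hint' (-((v ^ M)⁻¹ : (𝓞 K)ˣ) * x)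
  rw [← hx] at ha
  rw [← hx'] at hb
  have hab : a * b = 1 := toRat_injective (by
    rw [map_mul, ha, hb, map_one, ← Subalgebra.coe_mul, ← map_mul, Units.mul_inv, map_one,
      Subalgebra.coe_one])
  have hba : b * a = 1 := toRat_injective (by
    rw [map_mul, ha, hb, map_one, ← Subalgebra.coe_mul, ← map_mul, Units.inv_mul, map_one,
      Subalgebra.coe_one])
  have hac : a ∈ Subalgebra.center ℤ (MonoidAlgebra ℤ G) :=
    toRat_mem_center_iff.mp (ha ▸ (s _).2)
  obtain ⟨g, hg⟩ := isCut_iff.mp hG ⟨a, b, hab, hba⟩ hac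
  have hpow : a ^ (2 * Fintype.card G) = 1 := by
    -- Squaring removes the sign, whence the exponent `2 * |G|`.
    have h1 : a ^ 2 = MonoidAlgebra.of ℤ G g ^ 2 := by
      rcases hg with hg | hg
      · exact congrArg (· ^ 2) hg
      · exact (congrArg (· ^ 2) hg).trans (neg_sq _)
    rw [pow_mul, h1, ← pow_mul, mul_comm, pow_mul, ← map_pow, pow_card_eq_one, map_one, one_pow]
  have hvpow : s (((v ^ M) ^ (2 * Fintype.card G) : (𝓞 K)ˣ) : 𝓞 K) = s 1 := by
    apply Subtype.ext
    rw [Units.val_pow_eq_pow_val, map_pow, map_one, Subalgebra.coe_pow, ← ha, ← map_pow, hpow,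
      map_one, Subalgebra.coe_one]
  have h1 : (v ^ M) ^ (2 * Fintype.card G) = 1 := Units.ext (hs hvpow)
  rw [← pow_mul] at h1
  exact isOfFinOrder_iff_pow_eq_one.mpr
    ⟨_, Nat.mul_pos hM (Nat.mul_pos two_pos Fintype.card_pos), h1⟩

/-- The kernel of the point `φ` of the centre is maximal, so its image is a field; it contains the
values of `φ`, hence equals `charField φ`. The units of this component are torsion. -/
theorem isRatOrImagQuad_of_isCut (hG : IsCut G) {φ : G → ℂ} (hφ : IsSpherical φ) :
    IsRatOrImagQuad (charField φ) := by
  let f := centerHom ℚ hφ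
  have hp : (RingHom.ker f).IsPrime := RingHom.ker_isPrime f.toRingHom
  have hmax : (RingHom.ker f).IsMaximal := inferInstance
  let m : MaximalSpectrum (Subalgebra.center ℚ (MonoidAlgebra ℚ G)) := ⟨RingHom.ker f, hmax⟩
  have hrange : f.range = (charField φ).toSubalgebra := by
    apply le_antisymm
    · rintro _ ⟨z, rfl⟩
      exact linExt_mem_charField φ z.1
    · let K : IntermediateField ℚ ℂ := f.range.toIntermediateField fun x hx => by
        obtain ⟨z, rfl⟩ := hx
        by_cases hz : z ∈ RingHom.ker f
        · have h0 : f z = 0 := hz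
          change (f z)⁻¹ ∈ f.range
          rw [h0, inv_zero]
          exact zero_mem _
        · obtain ⟨y, i, hi, hy⟩ := hmax.exists_inv hz
          refine ⟨y, eq_inv_of_mul_eq_one_left ?_⟩
          have h0 : f i = 0 := hi
          have h1 := congrArg f hy
          rw [map_add, map_mul, h0, add_zero, map_one] at h1
          exact h1
      have : charField φ ≤ K := IntermediateField.adjoin_le_iff.mpr (by
        rintro _ ⟨g, rfl⟩
        exact ⟨classAverage g, centerHom_classAverage hφ g⟩)
      exact this
  let e : (Subalgebra.center ℚ (MonoidAlgebra ℚ G) ⧸ RingHom.ker f) ≃ₐ[ℚ] charField φ :=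
    (Ideal.quotientKerEquivRange f).trans (Subalgebra.equivOfEq _ _ hrange)
  have : FiniteDimensional ℚ (charField φ) := e.toLinearEquiv.finiteDimensional
  have : NumberField (charField φ) := { to_charZero := inferInstance, to_finiteDimensional := this }
  rcases finrank_of_units_torsion (isOfFinOrder_of_isCut hG m e.symm.toRingEquiv)
    (charField φ).val.toRingHom with h | ⟨h, x, hx⟩
  · exact isRatOrImagQuad_of_finrank (Or.inl h)
  · exact isRatOrImagQuad_of_finrank (Or.inr ⟨h, x, x.2, hx⟩)

theorem isCut_iff_forall_charField :
    IsCut G ↔ ∀ φ : G → ℂ, IsSpherical φ → IsRatOrImagQuad (charField φ) :=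
  ⟨fun h _ hφ => isRatOrImagQuad_of_isCut h hφ, isCut_of_forall_charField⟩

end Dirichlet

/-! ### Spherical functions of direct products -/

section Products

/-- Used for the inclusion `s` of a factor: conjugating `s y` in `H` amounts to conjugating `y` by
the component `p h`, so averaging over `G` and over `H` agree. -/
theorem IsSpherical.comp_of_conj {G H : Type*} [Group G] [Fintype G] [Group H] [Fintype H]
    {φ : H → ℂ} (hφ : IsSpherical φ) (s : G →* H) (p : H → G)
    (hs : ∀ h y, h * s y * h⁻¹ = s (p h * y * (p h)⁻¹)) : IsSpherical fun g => φ (s g) := by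
  refine ⟨by simp [hφ.map_one], fun x y => ?_⟩
  apply mul_left_cancel₀ (card_ne_zero_complex H)
  calc (Fintype.card H : ℂ) * ∑ k, φ (s (x * (k * y * k⁻¹)))
      = ∑ _h : H, ∑ k, φ (s (x * (k * y * k⁻¹))) := by simp
    _ = ∑ h : H, ∑ k, φ (s x * (h * s (k * y * k⁻¹) * h⁻¹)) := by
        refine Finset.sum_congr rfl fun h _ => ?_
        rw [← Equiv.sum_comp (Equiv.mulLeft (p h))]
        refine Finset.sum_congr rfl fun k _ => ?_
        rw [hs, ← map_mul]
        simp [mul_assoc]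
    _ = ∑ k, ∑ h : H, φ (s x * (h * s (k * y * k⁻¹) * h⁻¹)) := Finset.sum_comm
    _ = ∑ _k : G, (Fintype.card H : ℂ) * (φ (s x) * φ (s y)) := by
        refine Finset.sum_congr rfl fun k _ => ?_
        rw [hφ.sum_mul_conj, map_mul, map_mul, _root_.map_inv, hφ.conj]
    _ = _ := by
        rw [Finset.sum_const, Finset.card_univ, nsmul_eq_mul]
        ring

/-- Every term of the averaging identity equals `φ (k * (a * b) * k⁻¹) = φ (a * b)`. For elements of
different factors, `k` is the component of `h` in the factor of `b`. -/
theorem IsSpherical.map_mul_of_conj {H : Type*} [Group H] [Fintype H] {φ : H → ℂ}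
    (hφ : IsSpherical φ) {a b : H}
    (hab : ∀ h, ∃ k, h * b * h⁻¹ = k * b * k⁻¹ ∧ k * a = a * k) : φ (a * b) = φ a * φ b := by
  apply mul_left_cancel₀ (card_ne_zero_complex H)
  rw [← hφ.sum_mul_conj, ← nsmul_eq_mul, ← Finset.card_univ, ← Finset.sum_const]
  refine Finset.sum_congr rfl fun h _ => ?_
  obtain ⟨k, hk, hka⟩ := hab h
  rw [hk, ← hφ.conj k (a * b), ← mul_assoc, ← mul_assoc, ← mul_assoc, hka]

/-- The set of character fields of the irreducible characters of a finite group. -/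
def charFields (G : Type*) [Group G] [Fintype G] : Set (IntermediateField ℚ ℂ) :=
  {K | ∃ φ : G → ℂ, IsSpherical φ ∧ charField φ = K}

theorem apply_mem_charField {G : Type*} (φ : G → ℂ) (g : G) : φ g ∈ charField φ :=
  IntermediateField.subset_adjoin ℚ _ (Set.mem_range_self g)

theorem charField_le_iff {G : Type*} {φ : G → ℂ} {K : IntermediateField ℚ ℂ} :
    charField φ ≤ K ↔ ∀ g, φ g ∈ K := by
  rw [charField, IntermediateField.adjoin_le_iff, Set.range_subset_iff]
  rfl

theorem charField_natCast_mul {G : Type*} {n : ℕ} (hn : n ≠ 0) {φ χ : G → ℂ} (h : ∀ g, χ g = n * φ g) :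
    charField χ = charField φ := by
  apply le_antisymm
  · refine charField_le_iff.mpr fun g => ?_
    rw [h]
    exact mul_mem (natCast_mem _ n) (apply_mem_charField φ g)
  · refine charField_le_iff.mpr fun g => ?_
    have hn' : (n : ℂ) ≠ 0 := Nat.cast_ne_zero.mpr hn
    have : φ g = (n : ℂ)⁻¹ * χ g := by rw [h]; field_simp
    rw [this]
    exact mul_mem (inv_mem (natCast_mem _ n)) (apply_mem_charField χ g)

section Single

variable {G : Type*} [Group G] [Fintype G]

theorem bot_mem_charFields : (⊥ : IntermediateField ℚ ℂ) ∈ charFields G :=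
  ⟨1, isSpherical_one, eq_bot_iff.mpr (charField_le_iff.mpr fun _ => one_mem _)⟩

theorem mem_charFields_iff {K : IntermediateField ℚ ℂ} :
    K ∈ charFields G ↔ ∃ χ ∈ Irr G, charField χ = K := by
  constructor
  · rintro ⟨φ, hφ, rfl⟩
    obtain ⟨n, χ, hn, hχ, h⟩ := exists_mem_Irr_of_isSpherical hφ
    exact ⟨χ, hχ, charField_natCast_mul hn h⟩
  · rintro ⟨χ, hχ, rfl⟩
    obtain ⟨n, φ, hn, hφ, h⟩ := exists_isSpherical_of_mem_Irr hχ
    exact ⟨φ, hφ, (charField_natCast_mul hn h).symm⟩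

theorem isRational_iff : IsRational G ↔ ∀ K ∈ charFields G, K = ⊥ := by
  simp only [mem_charFields_iff]
  exact ⟨fun h K ⟨χ, hχ, hK⟩ => hK ▸ h χ hχ, fun h χ hχ => h _ ⟨χ, hχ, rfl⟩⟩

theorem groupField_eq_sSup : groupField G = sSup (charFields G) := by
  apply le_antisymm
  · refine IntermediateField.adjoin_le_iff.mpr ?_
    rintro _ ⟨χ, hχ, x, rfl⟩
    exact le_sSup (mem_charFields_iff.mpr ⟨χ, hχ, rfl⟩) (apply_mem_charField χ x)
  · refine sSup_le fun K hK => ?_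
    obtain ⟨χ, hχ, rfl⟩ := mem_charFields_iff.mp hK
    exact charField_le_iff.mpr fun g => IntermediateField.subset_adjoin ℚ _ ⟨χ, hχ, g, rfl⟩

theorem isCut_iff_forall_charFields : IsCut G ↔ ∀ K ∈ charFields G, IsRatOrImagQuad K := by
  rw [isCut_iff_forall_charField]
  exact ⟨fun h K ⟨φ, hφ, hK⟩ => hK ▸ h φ hφ, fun h φ hφ => h _ ⟨φ, hφ, rfl⟩⟩

end Single

/-- Spherical functions of a product are the products of spherical functions of the factors. The
normalisation `φ 1 = 1` recovers each factor by restriction, so the field is the full composite. -/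
theorem mem_charFields_prod_iff {G₁ G₂ : Type*} [Group G₁] [Group G₂] [Fintype G₁] [Fintype G₂]
    {K : IntermediateField ℚ ℂ} :
    K ∈ charFields (G₁ × G₂) ↔ ∃ K₁ ∈ charFields G₁, ∃ K₂ ∈ charFields G₂, K = K₁ ⊔ K₂ := by
  have key : ∀ (φ : G₁ × G₂ → ℂ) (φ₁ : G₁ → ℂ) (φ₂ : G₂ → ℂ), (∀ x, φ (x, 1) = φ₁ x) →
      (∀ y, φ (1, y) = φ₂ y) → (∀ x y, φ (x, y) = φ₁ x * φ₂ y) →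
      charField φ = charField φ₁ ⊔ charField φ₂ := by
    intro φ φ₁ φ₂ h1 h2 h
    apply le_antisymm
    · refine charField_le_iff.mpr fun ⟨x, y⟩ => ?_
      rw [h]
      exact mul_mem ((le_sup_left : charField φ₁ ≤ _) (apply_mem_charField φ₁ x))
        ((le_sup_right : charField φ₂ ≤ _) (apply_mem_charField φ₂ y))
    · refine sup_le (charField_le_iff.mpr fun x => ?_) (charField_le_iff.mpr fun y => ?_)
      · rw [← h1]
        exact apply_mem_charField φ _
      · rw [← h2]
        exact apply_mem_charField φ _
  constructor
  · rintro ⟨φ, hφ, rfl⟩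
    refine ⟨_, ⟨_, hφ.comp_of_conj (MonoidHom.inl G₁ G₂) Prod.fst fun h y => ?_, rfl⟩, _,
      ⟨_, hφ.comp_of_conj (MonoidHom.inr G₁ G₂) Prod.snd fun h y => ?_, rfl⟩,
      key _ _ _ (fun _ => rfl) (fun _ => rfl) fun x y => ?_⟩
    · ext <;> simp
    · ext <;> simp
    · have h1 : ((x, y) : G₁ × G₂) = (x, 1) * (1, y) := by simp
      rw [h1]
      refine hφ.map_mul_of_conj fun h => ⟨(1, h.2), ?_, ?_⟩
      · ext <;> simp
      · ext <;> simp
  · rintro ⟨_, ⟨φ₁, h₁, rfl⟩, _, ⟨φ₂, h₂, rfl⟩, rfl⟩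
    refine ⟨fun z => φ₁ z.1 * φ₂ z.2, ⟨by simp [h₁.map_one, h₂.map_one], fun x y => ?_⟩,
      key _ _ _ (fun x => by simp [h₂.map_one]) (fun y => by simp [h₁.map_one]) fun _ _ => rfl⟩
    rw [Fintype.sum_prod_type]
    simp only [Prod.fst_mul, Prod.snd_mul, Prod.fst_inv, Prod.snd_inv]
    rw [← Finset.sum_mul_sum, h₁.sum_mul_conj, h₂.sum_mul_conj, Fintype.card_prod]
    push_cast
    ring

theorem IsSpherical.eq_prod_mulSingle {ι : Type*} [Fintype ι] [DecidableEq ι] {G : ι → Type*}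
    [∀ i, Group (G i)] [∀ i, Fintype (G i)] {φ : (∀ i, G i) → ℂ} (hφ : IsSpherical φ)
    (x : ∀ i, G i) : φ x = ∏ i, φ (Pi.mulSingle i (x i)) := by
  have key : ∀ s : Finset ι, φ (fun j => if j ∈ s then x j else 1) =
      ∏ i ∈ s, φ (Pi.mulSingle i (x i)) := by
    intro s
    induction s using Finset.induction_on with
    | empty => exact hφ.map_one
    | insert i s hi ih =>
      have h1 : (fun j => if j ∈ insert i s then x j else 1) =
          (fun j => if j ∈ s then x j else 1) * Pi.mulSingle i (x i) := by
        funext j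
        by_cases hj : j = i
        · subst hj
          simp [hi]
        · simp [hj]
      rw [h1, Finset.prod_insert hi, _root_.mul_comm, ← ih]
      refine hφ.map_mul_of_conj fun h => ⟨Pi.mulSingle i (h i), ?_, ?_⟩
      · funext j
        by_cases hj : j = i
        · subst hj
          simp
        · simp [Pi.mulSingle_eq_of_ne hj]
      · funext j
        by_cases hj : j = i
        · subst hj
          simp [hi]
        · simp [Pi.mulSingle_eq_of_ne hj]
  simpa using key Finset.univ

theorem mem_charFields_pi_iff {ι : Type*} [Fintype ι] [DecidableEq ι] {G : ι → Type*}
    [∀ i, Group (G i)] [∀ i, Fintype (G i)] {K : IntermediateField ℚ ℂ} :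
    K ∈ charFields (∀ i, G i) ↔
      ∃ L : ι → IntermediateField ℚ ℂ, (∀ i, L i ∈ charFields (G i)) ∧ K = ⨆ i, L i := by
  have key : ∀ (φ : (∀ i, G i) → ℂ) (ψ : ∀ i, G i → ℂ),
      (∀ i x, φ (Pi.mulSingle i x) = ψ i x) → (∀ x, φ x = ∏ i, ψ i (x i)) →
      charField φ = ⨆ i, charField (ψ i) := by
    intro φ ψ h1 h
    apply le_antisymm
    · refine charField_le_iff.mpr fun x => ?_
      rw [h]
      exact prod_mem fun i _ => le_iSup (fun i => charField (ψ i)) i (apply_mem_charField _ _)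
    · refine iSup_le fun i => charField_le_iff.mpr fun x => ?_
      rw [← h1]
      exact apply_mem_charField φ _
  constructor
  · rintro ⟨φ, hφ, rfl⟩
    refine ⟨fun i => charField fun x => φ (Pi.mulSingle i x), fun i =>
      ⟨_, hφ.comp_of_conj (MonoidHom.mulSingle G i) (fun h => h i) fun h y => ?_, rfl⟩,
      key _ _ (fun _ _ => rfl) hφ.eq_prod_mulSingle⟩
    funext j
    by_cases hj : j = i
    · subst hj
      simp
    · simp [Pi.mulSingle_eq_of_ne hj]
  · rintro ⟨L, hL, rfl⟩
    choose ψ hψ hL using hL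
    obtain rfl : (fun i => charField (ψ i)) = L := funext hL
    refine ⟨fun x => ∏ i, ψ i (x i), ⟨by simp [(hψ _).map_one], fun x y => ?_⟩,
      key _ _ (fun i x => ?_) fun _ => rfl⟩
    · have h1 := Finset.prod_univ_sum (fun i => (Finset.univ : Finset (G i)))
        (fun i h => ψ i (x i * (h * y i * h⁻¹)))
      rw [Fintype.piFinset_univ] at h1
      simp only [Pi.mul_apply, Pi.inv_apply]
      rw [← h1, Fintype.card_pi]
      simp only [(hψ _).sum_mul_conj, Finset.prod_mul_distrib]
      push_cast
      ring
    · rw [Finset.prod_eq_single i]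
      · simp
      · intro j _ hj
        simp [Pi.mulSingle_eq_of_ne hj, (hψ j).map_one]
      · simp

end Products

/-! ### Composites of imaginary quadratic fields -/

/-- An imaginary quadratic field has no subfields besides `ℚ` and itself. -/
theorem eq_of_isRatOrImagQuad_sup {K L : IntermediateField ℚ ℂ} (h : IsRatOrImagQuad (K ⊔ L))
    (hK : K ≠ ⊥) (hL : L ≠ ⊥) : K = L := by
  rcases h with h | ⟨d, -, h⟩
  · exact absurd (eq_bot_iff.mpr (h ▸ le_sup_left)) hK
  · have h1 := (eq_bot_or_eq_of_le_imagQuadField (h ▸ le_sup_left : K ≤ _)).resolve_left hK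
    have h2 := (eq_bot_or_eq_of_le_imagQuadField (h ▸ le_sup_right : L ≤ _)).resolve_left hL
    rw [h1, h2]

/-- The lattice core of both parts of the theorem, with `S i` the set of character fields of the
`i`-th factor; `⊥` belongs to it through the trivial character. -/
theorem forall_isRatOrImagQuad_iSup_iff {ι : Type*} (S : ι → Set (IntermediateField ℚ ℂ))
    (hbot : ∀ i, ⊥ ∈ S i) (hS : ∀ i, ∀ K ∈ S i, IsRatOrImagQuad K) :
    (∀ L : ι → IntermediateField ℚ ℂ, (∀ i, L i ∈ S i) → IsRatOrImagQuad (⨆ i, L i)) ↔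
      {i | ¬ ∀ K ∈ S i, K = ⊥}.Subsingleton ∨
      ∃ d : ℕ, 0 < d ∧ ∀ i, (¬ ∀ K ∈ S i, K = ⊥) → sSup (S i) = imagQuadField d := by
  classical
  constructor
  · intro h
    have hsup : ∀ i j, i ≠ j → ∀ K ∈ S i, ∀ L ∈ S j, K ≠ ⊥ → L ≠ ⊥ → K = L := by
      intro i j hij K hK L hL hK0 hL0
      -- Trivial fields away from `i` and `j` reduce the composite to `K ⊔ L`.
      let F : ι → IntermediateField ℚ ℂ := fun l => if l = i then K else if l = j then L else ⊥
      have hF : ∀ l, F l ∈ S l := fun l => by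
        by_cases h1 : l = i
        · subst h1
          simpa [F] using hK
        · by_cases h2 : l = j
          · subst h2
            simpa [F, h1] using hL
          · simpa [F, h1, h2] using hbot l
      have hFsup : ⨆ l, F l = K ⊔ L := by
        apply le_antisymm
        · refine iSup_le fun l => ?_
          by_cases h1 : l = i
          · simp [F, h1]
          · by_cases h2 : l = j
            · subst h2
              simp [F, h1]
            · simp [F, h1, h2]
        · refine sup_le ?_ ?_
          · simpa [F] using le_iSup F i
          · simpa [F, hij.symm] using le_iSup F j
      exact eq_of_isRatOrImagQuad_sup (hFsup ▸ h F hF) hK0 hL0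
    refine or_iff_not_imp_left.mpr fun hns => ?_
    obtain ⟨i, hi, j, hj, hij⟩ := Set.not_subsingleton_iff.mp hns
    obtain ⟨K, hK, hK0⟩ : ∃ K ∈ S i, K ≠ ⊥ := by simpa using hi
    obtain ⟨L, hL, hL0⟩ : ∃ L ∈ S j, L ≠ ⊥ := by simpa using hj
    have hKL := hsup i j hij K hK L hL hK0 hL0
    obtain ⟨d, hd, hKd⟩ := (hS i K hK).resolve_left hK0
    refine ⟨d, hd, fun l hl => ?_⟩
    have hl' : ∀ M ∈ S l, M ≠ ⊥ → M = imagQuadField d := by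
      intro M hM hM0
      -- Fields are only comparable across different indices, so for `l = i` the comparison goes
      -- through `L` in `S j`, which equals `K`.
      by_cases hli : l = i
      · subst hli
        rw [← hKd, hKL]
        exact hsup l j hij M hM L hL hM0 hL0
      · rw [← hKd]
        exact hsup l i hli M hM K hK hM0 hK0
    apply le_antisymm
    · refine sSup_le fun M hM => ?_
      by_cases hM0 : M = ⊥
      · exact hM0 ▸ bot_le
      · exact (hl' M hM hM0).le
    · obtain ⟨M, hM, hM0⟩ : ∃ M ∈ S l, M ≠ ⊥ := by simpa using hl
      rw [← hl' M hM hM0]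
      exact le_sSup hM
  · rintro (h | ⟨d, hd, h⟩) L hL
    · by_cases hall : ∀ i, L i = ⊥
      · left
        simp [hall]
      · push Not at hall
        obtain ⟨i, hi⟩ := hall
        have : ⨆ l, L l = L i := by
          refine le_antisymm (iSup_le fun l => ?_) (le_iSup L i)
          by_cases hl : L l = ⊥
          · exact hl ▸ bot_le
          · have hli : l = i := h (fun hh => hl (hh _ (hL l))) (fun hh => hi (hh _ (hL i)))
            rw [hli]
        rw [this]
        exact hS i _ (hL i)
    · have hle : ⨆ l, L l ≤ imagQuadField d := by
        refine iSup_le fun l => ?_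
        by_cases hl : ∀ K ∈ S l, K = ⊥
        · rw [hl _ (hL l)]
          exact bot_le
        · rw [← h l hl]
          exact le_sSup (hL l)
      exact (eq_bot_or_eq_of_le_imagQuadField hle).imp id fun h => ⟨d, hd, h⟩

theorem isCut_pi_iff {ι : Type*} [Finite ι] {G : ι → Type*} [∀ i, Group (G i)]
    [∀ i, Finite (G i)] (hG : ∀ i, IsCut (G i)) :
    IsCut (∀ i, G i) ↔ {i | ¬ IsRational (G i)}.Subsingleton ∨
      ∃ d : ℕ, 0 < d ∧ ∀ i, ¬ IsRational (G i) → groupField (G i) = imagQuadField d := by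
  classical
  have := Fintype.ofFinite ι
  have := fun i => Fintype.ofFinite (G i)
  have h := forall_isRatOrImagQuad_iSup_iff (fun i => charFields (G i))
    (fun i => bot_mem_charFields) fun i => isCut_iff_forall_charFields.mp (hG i)
  simp only [isRational_iff, groupField_eq_sSup]
  rw [← h, isCut_iff_forall_charFields]
  simp only [mem_charFields_pi_iff]
  exact ⟨fun h L hL => h _ ⟨L, hL, rfl⟩, fun h K ⟨L, hL, hK⟩ => hK ▸ h L hL⟩

theorem isCut_prod_iff {G₁ G₂ : Type*} [Group G₁] [Group G₂] [Finite G₁] [Finite G₂]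
    (h₁ : IsCut G₁) (h₂ : IsCut G₂) :
    IsCut (G₁ × G₂) ↔ (IsRational G₁ ∨ IsRational G₂) ∨
      ∃ d : ℕ, 0 < d ∧ groupField G₁ = imagQuadField d ∧ groupField G₂ = imagQuadField d := by
  have := Fintype.ofFinite G₁
  have := Fintype.ofFinite G₂
  have h := forall_isRatOrImagQuad_iSup_iff
    (fun b : Bool => bif b then charFields G₁ else charFields G₂)
    (Bool.rec bot_mem_charFields bot_mem_charFields)
    (Bool.rec (isCut_iff_forall_charFields.mp h₂) (isCut_iff_forall_charFields.mp h₁))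
  have hcut : IsCut (G₁ × G₂) ↔ ∀ L : Bool → IntermediateField ℚ ℂ,
      (∀ b, L b ∈ bif b then charFields G₁ else charFields G₂) →
        IsRatOrImagQuad (⨆ b, L b) := by
    rw [isCut_iff_forall_charFields]
    simp only [mem_charFields_prod_iff, iSup_bool_eq]
    constructor
    · exact fun hh L hL => hh _ ⟨_, hL true, _, hL false, rfl⟩
    · rintro hh _ ⟨K₁, hK₁, K₂, hK₂, rfl⟩
      exact hh (fun b => bif b then K₁ else K₂) (Bool.rec hK₂ hK₁)
  rw [hcut, h]
  simp only [isRational_iff, groupField_eq_sSup, Bool.forall_bool, cond_true, cond_false]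
  have hsub : {b : Bool | ¬ ∀ K ∈ bif b then charFields G₁ else charFields G₂, K = ⊥}.Subsingleton ↔
      (∀ K ∈ charFields G₁, K = ⊥) ∨ ∀ K ∈ charFields G₂, K = ⊥ := by
    constructor
    · intro hs
      by_contra! hc
      have : true = false := hs (by simpa using hc.1) (by simpa using hc.2)
      exact Bool.noConfusion this
    · rintro (hr | hr) b hb c hc
      · cases b <;> cases c <;> first | rfl | exact absurd hr hb | exact absurd hr hc
      · cases b <;> cases c <;> first | rfl | exact absurd hr hb | exact absurd hr hc
  rw [hsub]
  constructor
  · rintro (hr | ⟨d, hd, e₂, e₁⟩)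
    · exact Or.inl hr
    · by_cases hr : (∀ K ∈ charFields G₁, K = ⊥) ∨ ∀ K ∈ charFields G₂, K = ⊥
      · exact Or.inl hr
      · rw [not_or] at hr
        exact Or.inr ⟨d, hd, e₁ hr.1, e₂ hr.2⟩
  · rintro (hr | ⟨d, hd, e₁, e₂⟩)
    · exact Or.inl hr
    · exact Or.inr ⟨d, hd, fun _ => e₂, fun _ => e₁⟩

end CutGroups

end

theorem mainTheorem2 :
    (∀ (G₁ G₂ : Type*) [Group G₁] [Group G₂] [Finite G₁] [Finite G₂],
      CutGroups.IsCut G₁ → CutGroups.IsCut G₂ →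
      (CutGroups.IsCut (G₁ × G₂) ↔
        (CutGroups.IsRational G₁ ∨ CutGroups.IsRational G₂) ∨
        ∃ d : ℕ, 0 < d ∧
          CutGroups.groupField G₁ = CutGroups.imagQuadField d ∧
          CutGroups.groupField G₂ = CutGroups.imagQuadField d)) ∧
    (∀ (ι : Type*) [Finite ι] (G : ι → Type*) [∀ i, Group (G i)] [∀ i, Finite (G i)],
      (∀ i, CutGroups.IsCut (G i)) →
      (CutGroups.IsCut (∀ i, G i) ↔
        {i | ¬ CutGroups.IsRational (G i)}.Subsingleton ∨
        ∃ d : ℕ, 0 < d ∧ ∀ i, ¬ CutGroups.IsRational (G i) →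
          CutGroups.groupField (G i) = CutGroups.imagQuadField d)) := by
  exact ⟨fun _ _ _ _ _ _ h₁ h₂ => CutGroups.isCut_prod_iff h₁ h₂,
    fun _ _ _ _ _ hG => CutGroups.isCut_pi_iff hG⟩
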